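/- Let $\mathbb D$ be the open unit disc, $\mathbb T$ its boundary, and let $\mathcal A$ be the Neil algebra: the unital algebra of all functions $f$ that are continuous on $\overline{\mathbb D}$, analytic on $\mathbb D$, and satisfy $f'(0)=0$. For $F\in M_n(\mathcal A)$ put $\|F\|_n=\sup_{z\in\mathbb D}\|F(z)\|$ (operator norm of $n\times n$ matrices). A representation of $\mathcal A$ on a Hilbert space $H$ is an algebra homomorphism $\pi:\mathcal A\to B(H)$. It is - unital if $\pi(1)=I$; - completely contractive if $\|(\pi(F_{jk}))_{j,k}\|_{B(H^{\oplus n})}\le\|F\|_n$ for all $n$ and all $F\in M_n(\mathcal A)$; - pure if $\bigcap_a \pi(a)H=(0)$, where $a$ runs over the inner elements of $\mathcal A$, i.e. those with $|a|=1$ on $\mathbb T$; - extremal if, whenever $\rho:\mathcal A\to B(K)$ is a completely contractive representation on a Hilbert space $K$ and $V:H\to K$ is an isometry with $\pi(a)=V^*\rho(a)V$ for all $a\in\mathcal A$, then $V\pi(a)=\rho(a)V$ for all $a\in\mathcal A$; - of rank one if there do not exist two nonzero closed subspaces of $H$ that are orthogonal to each other and both invariant under $\pi(a)$ for all $a\in\mathcal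 A$. For a subspace $\mathcal V\subset\mathbb C\oplus\mathbb Cz$ of the Hardy space $\mathrm H^2\subset L^2(\mathbb T)$ let $\mathrm H^2_{\mathcal V}=\mathrm H^2\ominus\mathcal V$ and let $\pi_{\mathcal V}:\mathcal A\to B(\mathrm H^2_{\mathcal V})$ be the representation $\pi_{\mathcal V}(a)f=af$. Corollary. For every subspace $\mathcal V\subset\mathbb C\oplus\mathbb Cz$ the representation $\pi_{\mathcal V}$ has rank one. Moreover, if $\pi$ is a unital, pure, extremal, completely contractive, rank one representation of $\mathcal A$ on a nonzero Hilbert space, then there is a subspace $\mathcal V\subset\mathbb C\oplus\mathbb Cz$ such that $\pi$ is unitarily equivalent to $\pi_{\mathcal V}$. -/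

import Mathlib

open MeasureTheory Metric AddCircle
open scoped ENNReal InnerProductSpace

universe u v

noncomputable section

namespace NeilAlg

/-! ### The disc algebra and the Neil algebra -/

/-- The closed unit disc of `ℂ`. -/
abbrev Disc : Type := closedBall (0 : ℂ) 1

open Classical in
/-- A function on the closed unit disc, extended by `0` to all of `ℂ`.  Only its values on the
closed disc, and its derivatives at points of the open disc, are ever used. -/
def ext0 (f : C(Disc, ℂ)) : ℂ → ℂ :=
  fun z => if h : z ∈ closedBall (0 : ℂ) 1 then f ⟨z, h⟩ else 0

theorem ext0_of_mem (f : C(Disc, ℂ)) {z : ℂ} (h : z ∈ closedBall (0 : ℂ) 1) :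
    ext0 f z = f ⟨z, h⟩ := by
  simp only [ext0, dif_pos h]

theorem ext0_mul (f g : C(Disc, ℂ)) : ext0 (f * g) = ext0 f * ext0 g := by
  funext z
  by_cases h : z ∈ closedBall (0 : ℂ) 1
  · simp [ext0_of_mem _ h]
  · simp only [ext0, dif_neg h, Pi.mul_apply, mul_zero]

theorem ext0_add (f g : C(Disc, ℂ)) : ext0 (f + g) = ext0 f + ext0 g := by
  funext z
  by_cases h : z ∈ closedBall (0 : ℂ) 1
  · simp [ext0_of_mem _ h]
  · simp only [ext0, dif_neg h, Pi.add_apply, add_zero]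

theorem ext0_algebraMap_eqOn (c : ℂ) :
    Set.EqOn (ext0 (algebraMap ℂ C(Disc, ℂ) c)) (fun _ => c) (ball 0 1) := by
  intro z hz
  rw [ext0_of_mem _ (ball_subset_closedBall hz)]
  simp

/-- The disc algebra: functions continuous on the closed unit disc and analytic on the open
unit disc. -/
def discAlgebra : Subalgebra ℂ C(Disc, ℂ) where
  carrier := {f | DifferentiableOn ℂ (ext0 f) (ball 0 1)}
  mul_mem' {f g} hf hg := by
    simp only [Set.mem_ofPred_eq] at hf hg ⊢
    rw [ext0_mul]; exact hf.mul hg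
  add_mem' {f g} hf hg := by
    simp only [Set.mem_ofPred_eq] at hf hg ⊢
    rw [ext0_add]; exact hf.add hg
  algebraMap_mem' c := (differentiableOn_const c).congr (ext0_algebraMap_eqOn c)

theorem differentiableAt_zero {f : C(Disc, ℂ)} (hf : f ∈ discAlgebra) :
    DifferentiableAt ℂ (ext0 f) 0 :=
  DifferentiableOn.differentiableAt (s := ball 0 1) hf (ball_mem_nhds 0 one_pos)

/-- The Neil algebra: the elements `f` of the disc algebra with `f'(0) = 0`. -/
def neilAlgebra : Subalgebra ℂ C(Disc, ℂ) where
  carrier := {f | f ∈ discAlgebra ∧ deriv (ext0 f) 0 = 0}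
  mul_mem' {f g} hf hg := by
    refine ⟨mul_mem hf.1 hg.1, ?_⟩
    rw [ext0_mul, deriv_mul (differentiableAt_zero hf.1) (differentiableAt_zero hg.1),
      hf.2, hg.2, zero_mul, mul_zero, add_zero]
  add_mem' {f g} hf hg := by
    refine ⟨add_mem hf.1 hg.1, ?_⟩
    rw [ext0_add, deriv_add (differentiableAt_zero hf.1) (differentiableAt_zero hg.1),
      hf.2, hg.2, add_zero]
  algebraMap_mem' c := by
    refine ⟨Subalgebra.algebraMap_mem _ c, ?_⟩
    rw [((ext0_algebraMap_eqOn c).eventuallyEq_of_mem (ball_mem_nhds 0 one_pos)).deriv_eq]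
    simp

/-- The norm of a matrix over the Neil algebra: the supremum over the open unit disc of the
operator norms of the scalar matrices `F(z)`. -/
def matNorm {n : ℕ} (F : Matrix (Fin n) (Fin n) neilAlgebra) : ℝ :=
  ⨆ z : ball (0 : ℂ) 1, ‖Matrix.toEuclideanCLM (n := Fin n) (𝕜 := ℂ)
    (Matrix.of fun j k => (F j k : C(Disc, ℂ)) ⟨z, ball_subset_closedBall z.2⟩)‖

/-- An element of the Neil algebra is inner if it is unimodular on the unit circle. -/
def IsInner (a : neilAlgebra) : Prop :=
  ∀ z : Disc, ‖(z : ℂ)‖ = 1 → ‖(a : C(Disc, ℂ)) z‖ = 1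

/-! ### Representations -/

section Representations

variable (H : Type u) [NormedAddCommGroup H] [InnerProductSpace ℂ H]

/-- A representation of the Neil algebra on `H`: a (not necessarily unital) algebra homomorphism
into the bounded operators on `H`. -/
abbrev Rep : Type u := neilAlgebra →ₙₐ[ℂ] (H →L[ℂ] H)

variable {H}

/-- The operator on the Hilbert space direct sum `H ⊕ ⋯ ⊕ H` given by a matrix of operators. -/
def blockOp {n : ℕ} (T : Matrix (Fin n) (Fin n) (H →L[ℂ] H)) :
    PiLp 2 (fun _ : Fin n => H) →L[ℂ] PiLp 2 (fun _ : Fin n => H) :=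
  (PiLp.continuousLinearEquiv 2 ℂ (fun _ : Fin n => H)).symm.toContinuousLinearMap ∘L
    ContinuousLinearMap.pi (fun j => ∑ k, T j k ∘L ContinuousLinearMap.proj k) ∘L
    (PiLp.continuousLinearEquiv 2 ℂ (fun _ : Fin n => H)).toContinuousLinearMap

theorem blockOp_apply {n : ℕ} (T : Matrix (Fin n) (Fin n) (H →L[ℂ] H))
    (x : PiLp 2 (fun _ : Fin n => H)) (j : Fin n) : blockOp T x j = ∑ k, T j k (x k) := by
  simp [blockOp]

/-- The representation is unital. -/
def IsUnital (π : Rep H) : Prop := π 1 = 1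

/-- The representation is completely contractive: for every `n`, its entrywise application to
`n × n` matrices is a contraction. -/
def IsCompletelyContractive (π : Rep H) : Prop :=
  ∀ (n : ℕ) (F : Matrix (Fin n) (Fin n) neilAlgebra), ‖blockOp (F.map π)‖ ≤ matNorm F

/-- The representation is pure: the ranges of the operators `π(a)`, `a` inner, have trivial
intersection. -/
def IsPure (π : Rep H) : Prop :=
  ∀ h : H, (∀ a : neilAlgebra, IsInner a → ∃ g : H, π a g = h) → h = 0

/-- The representation is extremal: every isometric compression to it of a completely contractive
representation is an intertwining. -/
def IsExtremal [CompleteSpace H] (π : Rep H) : Prop :=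
  ∀ (K : Type u) [NormedAddCommGroup K] [InnerProductSpace ℂ K] [CompleteSpace K]
    (ρ : Rep K) (V : H →ₗᵢ[ℂ] K), IsCompletelyContractive ρ →
    (∀ a, π a = ContinuousLinearMap.adjoint V.toContinuousLinearMap ∘L ρ a ∘L
      V.toContinuousLinearMap) →
    ∀ a, V.toContinuousLinearMap ∘L π a = ρ a ∘L V.toContinuousLinearMap

/-- The subspace `M` is invariant for the representation. -/
def IsInvariant (π : Rep H) (M : Submodule ℂ H) : Prop := ∀ a, ∀ x ∈ M, π a x ∈ M

/-- The representation has rank one: there is no pair of nonzero invariant subspaces that are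
orthogonal to each other. -/
def IsRankOne (π : Rep H) : Prop :=
  ¬ ∃ M N : Submodule ℂ H, IsClosed (M : Set H) ∧ IsClosed (N : Set H) ∧ M ≠ ⊥ ∧ N ≠ ⊥ ∧
    M ⟂ N ∧ IsInvariant π M ∧ IsInvariant π N

/-- Unitary equivalence of representations. -/
def UnitarilyEquiv {H' : Type v} [NormedAddCommGroup H'] [InnerProductSpace ℂ H']
    (π : Rep H) (π' : Rep H') : Prop :=
  ∃ U : H ≃ₗᵢ[ℂ] H', ∀ a h, U (π a h) = π' a (U h)

end Representations

/-! ### Hardy spaces on the circle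

The unit circle is parametrized by `t ∈ ℝ/ℤ`, `z = exp (2 π i t)`, with normalized arclength, so
that the function `z ^ n` is `fourier n`. -/

/-- `L²` of the unit circle. -/
abbrev L2 : Type := Lp ℂ 2 (haarAddCircle : Measure UnitAddCircle)

/-- The classical Hardy space `H²`: the functions in `L²` of the circle whose negative Fourier
coefficients vanish. -/
def H2 : Submodule ℂ L2 where
  carrier := {f | ∀ n : ℤ, n < 0 → ⟪fourierLp (T := 1) 2 n, f⟫_ℂ = 0}
  add_mem' hf hg n hn := by rw [inner_add_right, hf n hn, hg n hn, add_zero]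
  zero_mem' n _ := inner_zero_right _
  smul_mem' c f hf n hn := by rw [inner_smul_right, hf n hn, mul_zero]

/-- The subspace `ℂ ⊕ ℂ z` of `H²`. -/
def CCz : Submodule ℂ L2 :=
  Submodule.span ℂ {fourierLp (T := 1) 2 0, fourierLp (T := 1) 2 1}

/-- `H²_𝒱 = H² ⊖ 𝒱`. -/
def H2V (V : Submodule ℂ L2) : Submodule ℂ L2 := H2 ⊓ Vᗮ

/-- The parametrization `t ↦ exp (2 π i t)` of the unit circle. -/
def circ : C(UnitAddCircle, Disc) where
  toFun t := ⟨fourier 1 t, by simp [fourier_apply, Circle.norm_coe]⟩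
  continuous_toFun := by fun_prop

/-- The boundary values of a function on the closed disc. -/
def bdry (a : C(Disc, ℂ)) : C(UnitAddCircle, ℂ) := a.comp circ

/-- Multiplication by a continuous function on `L²` of the circle. -/
def mulL2 (g : C(UnitAddCircle, ℂ)) : L2 →L[ℂ] L2 :=
  (ContinuousLinearMap.mul ℂ ℂ).holderL haarAddCircle ∞ 2 2
    (ContinuousMap.toLp ∞ haarAddCircle ℂ g)

theorem coeFn_mulL2 (g : C(UnitAddCircle, ℂ)) (f : L2) :
    mulL2 g f =ᵐ[haarAddCircle] fun t => g t * f t := by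
  have h1 := (ContinuousLinearMap.mul ℂ ℂ).coeFn_holder (r := 2)
    (ContinuousMap.toLp (p := ∞) (haarAddCircle : Measure UnitAddCircle) ℂ g) f
  have h2 := ContinuousMap.coeFn_toLp (p := ∞) (𝕜 := ℂ)
    (haarAddCircle : Measure UnitAddCircle) g
  filter_upwards [h1, h2] with t h1 h2
  exact h1.trans (by rw [h2, ContinuousLinearMap.mul_apply'])

theorem inner_fourier_mul (g : C(UnitAddCircle, ℂ)) (n k : ℤ) :
    ⟪fourierLp (T := 1) 2 n, mulL2 g (fourierLp (T := 1) 2 k)⟫_ℂ = fourierCoeff g (n - k) := by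
  rw [L2.inner_def, fourierCoeff]
  refine integral_congr_ae ?_
  filter_upwards [coeFn_mulL2 g (fourierLp 2 k), coeFn_fourierLp (T := 1) 2 k,
    coeFn_fourierLp (T := 1) 2 n] with t h1 h2 h3
  rw [h1, h2, h3, neg_sub, sub_eq_add_neg, fourier_add, fourier_neg]
  simp only [RCLike.inner_apply, smul_eq_mul]
  ring

theorem hasSum_inner_fourier_mul (g : C(UnitAddCircle, ℂ)) (f : L2) (n : ℤ) :
    HasSum (fun k : ℤ => ⟪fourierLp (T := 1) 2 k, f⟫_ℂ * fourierCoeff g (n - k))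
      ⟪fourierLp (T := 1) 2 n, mulL2 g f⟫_ℂ := by
  have h := (fourierBasis (T := 1)).hasSum_repr f
  have h' := h.mapL ((innerSL ℂ (fourierLp (T := 1) 2 n)) ∘L mulL2 g)
  refine Eq.mp (congrArg (fun F => HasSum F _) (funext fun k => ?_)) h'
  have := inner_fourier_mul g n k
  simp [HilbertBasis.repr_apply_apply, coe_fourierBasis, this]

theorem circleIntegral_eq_fourierCoeff (a : C(Disc, ℂ)) (n : ℤ) :
    (∮ z in C(0, 1), z ^ (-n - 1) * ext0 a z) =
      2 * Real.pi * Complex.I * fourierCoeff (bdry a) n := by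
  have hpi : (2 * Real.pi : ℝ) ≠ 0 := by positivity
  have h1 : ∀ x : ℝ, fourier (-n) (x : UnitAddCircle) • bdry a (x : UnitAddCircle) =
      (fun θ : ℝ => Complex.exp (θ * Complex.I) ^ (-n) * ext0 a (Complex.exp (θ * Complex.I)))
        (2 * Real.pi * x) := by
    intro x
    have h2 : (fourier 1 (x : UnitAddCircle) : ℂ) =
        Complex.exp (((2 * Real.pi * x : ℝ) : ℂ) * Complex.I) := by
      rw [fourier_coe_apply]
      congr 1
      push_cast
      ring
    have h3 : bdry a (x : UnitAddCircle) =
        ext0 a (Complex.exp (((2 * Real.pi * x : ℝ) : ℂ) * Complex.I)) := by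
      rw [← h2]
      exact (ext0_of_mem a (circ (x : UnitAddCircle)).2).symm
    have h4 : (fourier (-n) (x : UnitAddCircle) : ℂ) =
        Complex.exp (((2 * Real.pi * x : ℝ) : ℂ) * Complex.I) ^ (-n) := by
      rw [fourier_coe_apply, ← Complex.exp_int_mul]
      congr 1
      push_cast
      ring
    simp only [smul_eq_mul, h3, h4]
  rw [fourierCoeff_eq_intervalIntegral _ n 0]
  simp_rw [h1]
  rw [intervalIntegral.integral_comp_mul_left (fun θ : ℝ => Complex.exp (θ * Complex.I) ^ (-n) *
    ext0 a (Complex.exp (θ * Complex.I))) hpi]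
  simp only [circleIntegral, deriv_circleMap, circleMap, smul_eq_mul, zero_add, mul_zero, mul_one,
    Complex.ofReal_one, one_mul, one_div, inv_one, one_smul, Complex.real_smul]
  have h5 : ∀ θ : ℝ, Complex.exp (θ * Complex.I) * Complex.I *
      (Complex.exp (θ * Complex.I) ^ (-n - 1) * ext0 a (Complex.exp (θ * Complex.I))) =
      Complex.I * (Complex.exp (θ * Complex.I) ^ (-n) * ext0 a (Complex.exp (θ * Complex.I))) := by
    intro θ
    rw [zpow_sub_one₀ (Complex.exp_ne_zero _)]
    field_simp [Complex.exp_ne_zero]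
  simp_rw [h5]
  rw [intervalIntegral.integral_const_mul]
  push_cast
  field_simp

theorem diffContOnCl_ext0 {a : C(Disc, ℂ)} (ha : a ∈ discAlgebra) :
    DiffContOnCl ℂ (ext0 a) (ball 0 1) := by
  refine ⟨ha, ?_⟩
  rw [closure_ball _ one_ne_zero, continuousOn_iff_continuous_domRestrict]
  convert a.continuous using 1
  funext z
  exact ext0_of_mem a z.2

/-- The boundary Fourier coefficients of negative index of a function in the disc algebra
vanish. -/
theorem fourierCoeff_bdry_neg {a : C(Disc, ℂ)} (ha : a ∈ discAlgebra) {n : ℤ} (hn : n < 0) :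
    fourierCoeff (bdry a) n = 0 := by
  have h := circleIntegral_eq_fourierCoeff a n
  obtain ⟨k, hk⟩ := Int.eq_ofNat_of_zero_le (a := -n - 1) (by omega)
  have h0 : (∮ z in C(0, 1), z ^ (-n - 1) * ext0 a z) = 0 := by
    refine DiffContOnCl.circleIntegral_eq_zero zero_le_one ?_
    rw [hk]
    simp only [zpow_natCast]
    exact (differentiable_pow k).diffContOnCl.smul (diffContOnCl_ext0 ha)
  rw [h0] at h
  exact (mul_eq_zero.1 h.symm).resolve_left Complex.two_pi_I_ne_zero

/-- The boundary Fourier coefficient of index one of a function in the Neil algebra vanishes. -/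
theorem fourierCoeff_bdry_one {a : C(Disc, ℂ)} (ha : a ∈ neilAlgebra) :
    fourierCoeff (bdry a) 1 = 0 := by
  have h := circleIntegral_eq_fourierCoeff a 1
  have h0 : (∮ z in C(0, 1), z ^ (-1 - 1 : ℤ) * ext0 a z) = 0 := by
    have h1 := (diffContOnCl_ext0 ha.1).deriv_eq_smul_circleIntegral one_pos
    rw [ha.2, smul_zero] at h1
    rw [← h1]
    congr 1
    funext z
    rw [sub_zero, smul_eq_mul, one_div, show (-1 - 1 : ℤ) = -((2 : ℕ) : ℤ) by norm_num,
      zpow_neg, zpow_natCast]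
  rw [h0] at h
  exact (mul_eq_zero.1 h.symm).resolve_left Complex.two_pi_I_ne_zero

/-- `H²_𝒱` is invariant under multiplication by elements of the Neil algebra. -/
theorem mulL2_mem_H2V {V : Submodule ℂ L2} (hV : V ≤ CCz) {a : C(Disc, ℂ)}
    (ha : a ∈ neilAlgebra) {f : L2} (hf : f ∈ H2V V) : mulL2 (bdry a) f ∈ H2V V := by
  have key : ∀ n : ℤ, n ≤ 1 → ⟪fourierLp (T := 1) 2 n, mulL2 (bdry a) f⟫_ℂ =
      ⟪fourierLp (T := 1) 2 n, f⟫_ℂ * fourierCoeff (bdry a) 0 := by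
    intro n hn
    refine (hasSum_inner_fourier_mul (bdry a) f n).unique ?_
    have h1 := hasSum_single (f := fun k : ℤ =>
      ⟪fourierLp (T := 1) 2 k, f⟫_ℂ * fourierCoeff (bdry a) (n - k)) n ?_
    · simpa using h1
    intro k hk
    rcases lt_or_ge k 0 with hk0 | hk0
    · simp only [hf.1 k hk0, zero_mul]
    · rcases lt_or_ge n k with h | h
      · simp only [fourierCoeff_bdry_neg ha.1 (sub_neg.mpr h), mul_zero]
      · obtain rfl : k = 0 := by omega
        obtain rfl : n = 1 := by omega
        simp only [sub_zero, fourierCoeff_bdry_one ha, mul_zero]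
  refine ⟨fun n hn => by rw [key n (by omega), hf.1 n hn, zero_mul], ?_⟩
  refine (Submodule.mem_orthogonal V _).2 fun v hv => ?_
  have h0 := (Submodule.mem_orthogonal V f).1 hf.2 v hv
  obtain ⟨c, d, rfl⟩ := Submodule.mem_span_pair.1 (hV hv)
  simp only [inner_add_left, inner_smul_left, key 0 (by norm_num), key 1 le_rfl] at h0 ⊢
  linear_combination fourierCoeff (bdry a) 0 * h0

theorem mulL2_mul (g g' : C(UnitAddCircle, ℂ)) (f : L2) :
    mulL2 (g * g') f = mulL2 g (mulL2 g' f) := by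
  refine Lp.ext ?_
  filter_upwards [coeFn_mulL2 (g * g') f, coeFn_mulL2 g (mulL2 g' f), coeFn_mulL2 g' f]
    with t h1 h2 h3
  rw [h1, h2, h3, ContinuousMap.mul_apply, mul_assoc]

/-- The representation `π_𝒱(a) f = a f` of the Neil algebra on `H²_𝒱`. -/
def piV (V : Submodule ℂ L2) (hV : V ≤ CCz) : Rep (H2V V) where
  toFun a := (mulL2 (bdry a)).restrict (fun _ hf => mulL2_mem_H2V hV a.2 hf)
  map_smul' c a := by
    ext1 f
    apply Subtype.ext
    change mulL2 (c • bdry (a : C(Disc, ℂ))) f = c • mulL2 (bdry a) f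
    simp [mulL2]
  map_zero' := by
    ext1 f
    apply Subtype.ext
    change mulL2 0 f = 0
    simp [mulL2]
  map_add' a b := by
    ext1 f
    apply Subtype.ext
    change mulL2 (bdry (a : C(Disc, ℂ)) + bdry b) f = mulL2 (bdry a) f + mulL2 (bdry b) f
    simp [mulL2]
  map_mul' a b := by
    ext1 f
    apply Subtype.ext
    exact mulL2_mul (bdry (a : C(Disc, ℂ))) (bdry b) f

end NeilAlg

end

noncomputable section

namespace NeilAlg

open scoped ComplexConjugate

/-! Rank one of `π_𝒱`. If `f` and `g` lie in mutually orthogonal invariant subspaces, then `z^j f ⟂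
z^k g` for all `j, k ≠ 1`. The differences `j - k` exhaust `ℤ`, so `conj f * g` is orthogonal to
every continuous function and `f g = 0` almost everywhere (`ae_mul_eq_zero_of_orthogonal`). The
Fourier series of `f` and `g` are power series whose product is then zero, and `ℂ⟦X⟧` is a domain,
so `f` or `g` vanishes (`eq_zero_or_eq_zero_of_mul`).

Classification. Complete contractivity makes `π` positive on matrices whose real part is positive on
the circle. Equivalently, a functional on finitely supported kernels `H × H → 𝒜` is positive. The M.
Riesz extension theorem extends it to kernels with values in the continuous functions, and the GNS
construction for the extended functional yields a *-representation `ρ` on `K`, living on the circle,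
and an isometry `V : H → K` with `π(a) = V* ρ(a) V`: Arveson's extension and Stinespring's dilation
in one stroke. Extremality turns the compression into `V π(a) = ρ(a) V` (`exists_extension`).

Now `U = ρ(z)` is unitary and `P = V H` is stable under `U²` and `U³`. The closure `M` of `P + U P`
is stable under `U`, and `U² M ⊆ P ⊆ M`. Purity of `π` makes `U` on `M` a pure isometry; rank one
makes the wandering space `M ⊖ U M` one-dimensional, since orthogonal wandering vectors generate
orthogonal `ρ`-cyclic spaces. Hence `M` is a copy of `H²` (`exists_shift_model`), `P` corresponds to
a closed space between `z² H²` and `H²`, and such a space is `H² ⊖ 𝒱` with `𝒱 ⊆ ℂ ⊕ ℂ z`. -/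

/-- The coordinate function `z` on the closed disc. -/
def coord : C(Disc, ℂ) := ⟨Subtype.val, continuous_subtype_val⟩

theorem coord_apply (z : Disc) : coord z = z := rfl

theorem coord_pow_mem {m : ℕ} (hm : m ≠ 1) : coord ^ m ∈ neilAlgebra := by
  have h : Set.EqOn (ext0 (coord ^ m)) (fun z => z ^ m) (ball 0 1) := fun z hz => by
    rw [ext0_of_mem _ (ball_subset_closedBall hz)]; rfl
  refine ⟨(differentiable_pow m).differentiableOn.congr h, ?_⟩
  rw [(h.eventuallyEq_of_mem (ball_mem_nhds 0 one_pos)).deriv_eq]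
  rcases m with _ | _ | m
  · simp
  · exact absurd rfl hm
  · simp

/-- The monomial `z ^ m`, `m ≠ 1`, as an element of the Neil algebra. -/
def monomial (m : ℕ) (hm : m ≠ 1) : neilAlgebra := ⟨coord ^ m, coord_pow_mem hm⟩

/-! ### Matrix-valued functions and the maximum principle -/

/-- The value at a point of a matrix of functions, as an operator on Euclidean space. -/
def evalMat {n : ℕ} (F : Matrix (Fin n) (Fin n) C(Disc, ℂ)) (z : Disc) :
    EuclideanSpace ℂ (Fin n) →L[ℂ] EuclideanSpace ℂ (Fin n) :=
  Matrix.toEuclideanCLM (n := Fin n) (𝕜 := ℂ) (Matrix.of fun j k => F j k z)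

theorem evalMat_apply {n : ℕ} (F : Matrix (Fin n) (Fin n) C(Disc, ℂ)) (z : Disc)
    (c : EuclideanSpace ℂ (Fin n)) (j : Fin n) : evalMat F z c j = ∑ k, F j k z * c k := by
  simp [evalMat, Matrix.ofLp_toEuclideanCLM, Matrix.mulVec, dotProduct]

/-- The analytic extension by `0` of `evalMat` to the plane. -/
def evalExt {n : ℕ} (F : Matrix (Fin n) (Fin n) C(Disc, ℂ)) (z : ℂ) :
    EuclideanSpace ℂ (Fin n) →L[ℂ] EuclideanSpace ℂ (Fin n) :=
  ∑ j, ∑ k, ext0 (F j k) z •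
    Matrix.toEuclideanCLM (n := Fin n) (𝕜 := ℂ) (Matrix.single j k 1)

theorem evalExt_of_mem {n : ℕ} (F : Matrix (Fin n) (Fin n) C(Disc, ℂ)) (z : Disc) :
    evalExt F z = evalMat F z := by
  rw [evalMat, Matrix.matrix_eq_sum_single (Matrix.of fun j k => F j k z)]
  simp only [map_sum, evalExt, ext0_of_mem _ z.2, ← map_smul, Matrix.smul_single, smul_eq_mul,
    mul_one, Matrix.of_apply]

theorem continuousOn_ext0 (f : C(Disc, ℂ)) : ContinuousOn (ext0 f) (closedBall 0 1) := by
  rw [continuousOn_iff_continuous_domRestrict]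
  convert f.continuous using 1
  funext z
  exact ext0_of_mem _ z.2

theorem continuousOn_evalExt {n : ℕ} (F : Matrix (Fin n) (Fin n) C(Disc, ℂ)) :
    ContinuousOn (evalExt F) (closedBall 0 1) :=
  continuousOn_finsetSum _ fun j _ => continuousOn_finsetSum _ fun k _ =>
    (continuousOn_ext0 (F j k)).smul continuousOn_const

theorem differentiableOn_evalExt {n : ℕ} {F : Matrix (Fin n) (Fin n) C(Disc, ℂ)}
    (hF : ∀ j k, F j k ∈ discAlgebra) : DifferentiableOn ℂ (evalExt F) (ball 0 1) :=
  DifferentiableOn.fun_sum fun j _ => DifferentiableOn.fun_sum fun k _ =>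
    (show DifferentiableOn ℂ (ext0 (F j k)) _ from hF j k).smul (differentiableOn_const _)

/-- The matrix of continuous functions underlying a matrix over the Neil algebra. -/
abbrev toMat {n : ℕ} (F : Matrix (Fin n) (Fin n) neilAlgebra) :
    Matrix (Fin n) (Fin n) C(Disc, ℂ) := F.map Subtype.val

theorem exists_norm_evalMat_le {n : ℕ} (F : Matrix (Fin n) (Fin n) C(Disc, ℂ)) :
    ∃ C, 0 ≤ C ∧ ∀ z, ‖evalMat F z‖ ≤ C := by
  obtain ⟨C, hC⟩ := (isCompact_closedBall (0 : ℂ) 1).exists_bound_of_continuousOn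
    (continuousOn_evalExt F)
  refine ⟨max C 0, le_max_right _ _, fun z => ?_⟩
  rw [← evalExt_of_mem]
  exact (hC z z.2).trans (le_max_left _ _)

/-- `matNorm` only sees the open disc; boundary points are reached by continuity. -/
theorem norm_evalMat_le_matNorm {n : ℕ} (F : Matrix (Fin n) (Fin n) neilAlgebra) (z : Disc) :
    ‖evalMat (toMat F) z‖ ≤ matNorm F := by
  obtain ⟨C, -, hC⟩ := exists_norm_evalMat_le (toMat F)
  have h1 : ∀ w ∈ ball (0 : ℂ) 1, ‖evalExt (toMat F) w‖ ≤ matNorm F := by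
    intro w hw
    have h2 := evalExt_of_mem (toMat F) ⟨w, ball_subset_closedBall hw⟩
    rw [h2]
    refine le_ciSup (f := fun z : ball (0 : ℂ) 1 =>
      ‖evalMat (toMat F) ⟨z, ball_subset_closedBall z.2⟩‖) ?_ (⟨w, hw⟩ : ball (0 : ℂ) 1)
    exact ⟨C, Set.forall_mem_range.2 fun z => hC _⟩
  rw [← evalExt_of_mem]
  have hz : (z : ℂ) ∈ closure (ball (0 : ℂ) 1) := by
    rw [closure_ball _ one_ne_zero]; exact z.2
  refine ContinuousWithinAt.closure_le hz ?_ continuousWithinAt_const h1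
  exact (((continuousOn_evalExt (toMat F)) z z.2).mono ball_subset_closedBall).norm

/-- Maximum principle for matrices over the Neil algebra. -/
theorem matNorm_le {n : ℕ} {F : Matrix (Fin n) (Fin n) neilAlgebra} {C : ℝ}
    (hC : ∀ z : Disc, ‖(z : ℂ)‖ = 1 → ‖evalMat (toMat F) z‖ ≤ C) : matNorm F ≤ C := by
  have hd : DiffContOnCl ℂ (evalExt (toMat F)) (ball 0 1) := by
    refine ⟨differentiableOn_evalExt fun j k => (F j k).2.1, ?_⟩
    rw [closure_ball _ one_ne_zero]
    exact continuousOn_evalExt _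
  have : Nonempty (ball (0 : ℂ) 1) := ⟨0, mem_ball_self one_pos⟩
  refine ciSup_le fun z => ?_
  have h := Complex.norm_le_of_forall_mem_frontier_norm_le isBounded_ball hd (C := C) ?_
    (subset_closure z.2)
  · have h2 := evalExt_of_mem (toMat F) ⟨z, ball_subset_closedBall z.2⟩
    rw [h2] at h
    exact h
  · intro w hw
    rw [frontier_ball _ one_ne_zero] at hw
    have h2 := evalExt_of_mem (toMat F) ⟨w, sphere_subset_closedBall hw⟩
    rw [h2]
    exact hC _ (by simpa using hw)

/-! ### From complete contractivity to positivity -/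

section Positivity

variable {H : Type u} [NormedAddCommGroup H] [InnerProductSpace ℂ H]

theorem norm_sub_smul_sq {E : Type*} [NormedAddCommGroup E] [InnerProductSpace ℂ E]
    (x y : E) (ε : ℝ) : ‖x - (ε : ℂ) • y‖ ^ 2 =
      ‖x‖ ^ 2 - 2 * ε * (⟪x, y⟫_ℂ).re + ε ^ 2 * ‖y‖ ^ 2 := by
  rw [@norm_sub_sq ℂ, inner_smul_right, norm_smul]
  simp [mul_pow]
  ring

theorem nonneg_of_forall_mul_le {a b : ℝ} (h : ∀ ε : ℝ, 0 < ε → -(ε * b) ≤ a) : 0 ≤ a := by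
  have h1 : Filter.Tendsto (fun ε : ℝ => -(ε * b)) (nhdsWithin 0 (Set.Ioi 0)) (nhds 0) := by
    refine Filter.Tendsto.mono_left ?_ nhdsWithin_le_nhds
    have : Continuous fun ε : ℝ => -(ε * b) := by fun_prop
    simpa using this.tendsto 0
  exact le_of_tendsto h1 (eventually_nhdsWithin_of_forall fun ε hε => h ε hε)

/-- A unital completely contractive representation maps matrices with positive real part on the
circle to operators with positive real part. -/
theorem re_inner_blockOp_nonneg {π : Rep H} (hu : IsUnital π) (hc : IsCompletelyContractive π)
    {n : ℕ} (F : Matrix (Fin n) (Fin n) neilAlgebra)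
    (hF : ∀ z : Disc, ‖(z : ℂ)‖ = 1 → ∀ c, 0 ≤ (⟪c, evalMat (toMat F) z c⟫_ℂ).re)
    (x : PiLp 2 (fun _ : Fin n => H)) : 0 ≤ (⟪x, blockOp (F.map π) x⟫_ℂ).re := by
  obtain ⟨C, hC0, hC⟩ := exists_norm_evalMat_le (toMat F)
  -- On the circle the real part of `F` is nonnegative, so `1 - εF` has norm at most `√(1 + ε²C²)`.
  -- Expanding `‖x - εFx‖² ≤ (1 + ε²C²)‖x‖²` and dividing by `2ε` leaves the error `ε C² ‖x‖² / 2`.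
  refine nonneg_of_forall_mul_le (b := C ^ 2 * ‖x‖ ^ 2 / 2) fun ε hε => ?_
  set G : Matrix (Fin n) (Fin n) neilAlgebra := 1 - (ε : ℂ) • F with hG
  have hGe : ∀ j k z, toMat G j k z = (if j = k then 1 else 0) - (ε : ℂ) * toMat F j k z := by
    intro j k z
    rcases eq_or_ne j k with rfl | hjk <;> simp [-Complex.coe_smul, Matrix.map_apply, *]
  have hGπ : ∀ j k, G.map π j k = (if j = k then 1 else 0) - (ε : ℂ) • F.map π j k := by
    intro j k
    have hu' : π 1 = 1 := hu
    rcases eq_or_ne j k with rfl | hjk <;> simp [-Complex.coe_smul, Matrix.map_apply, *]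
  have hGz : ∀ z c, evalMat (toMat G) z c = c - (ε : ℂ) • evalMat (toMat F) z c := by
    intro z c
    ext j
    simp only [evalMat_apply, PiLp.sub_apply, PiLp.smul_apply, smul_eq_mul, Finset.mul_sum, hGe,
      sub_mul, Finset.sum_sub_distrib, ite_mul, one_mul, zero_mul, Finset.sum_ite_eq,
      Finset.mem_univ, if_true, mul_assoc]
  have hGx : blockOp (G.map π) x = x - (ε : ℂ) • blockOp (F.map π) x := by
    ext j
    have h1 : ∀ k, (if j = k then (1 : H →L[ℂ] H) else 0) (x k) = if j = k then x k else 0 := by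
      intro k; split_ifs <;> simp
    simp only [blockOp_apply, PiLp.sub_apply, PiLp.smul_apply, Finset.smul_sum, hGπ,
      _root_.sub_apply, _root_.smul_apply, Finset.sum_sub_distrib, h1,
      Finset.sum_ite_eq, Finset.mem_univ, if_true]
  have h1 : matNorm G ≤ √(1 + ε ^ 2 * C ^ 2) := by
    refine matNorm_le fun z hz => ContinuousLinearMap.opNorm_le_bound _ (Real.sqrt_nonneg _)
      fun c => ?_
    rw [hGz]
    refine le_of_sq_le_sq ?_ (by positivity)
    rw [norm_sub_smul_sq, mul_pow, Real.sq_sqrt (by positivity)]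
    have h2 := hF z hz c
    have h3 : ‖evalMat (toMat F) z c‖ ^ 2 ≤ (C * ‖c‖) ^ 2 := by
      gcongr
      exact (evalMat (toMat F) z).le_of_opNorm_le (hC z) c
    have h4 : ε ^ 2 * ‖evalMat (toMat F) z c‖ ^ 2 ≤ ε ^ 2 * (C * ‖c‖) ^ 2 := by gcongr
    have h5 : 0 ≤ 2 * ε * (⟪c, evalMat (toMat F) z c⟫_ℂ).re := by positivity
    linarith [mul_pow C ‖c‖ 2, mul_assoc (ε ^ 2) (C ^ 2) (‖c‖ ^ 2), h4, h5]
  have h2 : ‖x - (ε : ℂ) • blockOp (F.map π) x‖ ^ 2 ≤ (√(1 + ε ^ 2 * C ^ 2) * ‖x‖) ^ 2 := by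
    rw [← hGx]
    gcongr
    exact (blockOp (G.map π)).le_of_opNorm_le ((hc n G).trans h1) x
  rw [norm_sub_smul_sq, mul_pow, Real.sq_sqrt (by positivity)] at h2
  have h3 : 0 ≤ ε ^ 2 * ‖blockOp (F.map π) x‖ ^ 2 := by positivity
  refine le_of_mul_le_mul_left ?_ (show 0 < 2 * ε by positivity)
  nlinarith [h2, h3]

end Positivity

/-! ### Finitely supported kernels and their positive cone -/

section Kernels

variable {H : Type u}

/-- Passes from a kernel to a matrix indexed by `Fin n`, the form in which complete contractivity is
available. -/
theorem finsupp_sum_eq_sum_fin {M N : Type*} [AddCommMonoid M] [AddCommMonoid N]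
    (F : H × H →₀ M) {S : Finset H} (hS : F.support ⊆ S ×ˢ S) (g : H × H → M → N)
    (hg : ∀ p, g p 0 = 0) : F.sum g =
      ∑ j : Fin S.card, ∑ k : Fin S.card, g (S.equivFin.symm j, S.equivFin.symm k)
        (F (S.equivFin.symm j, S.equivFin.symm k)) := by
  rw [Finsupp.sum_of_support_subset F hS g fun p _ => hg p, Finset.sum_product]
  rw [← Finset.sum_coe_sort, ← Equiv.sum_comp S.equivFin.symm]
  refine Finset.sum_congr rfl fun j _ => ?_
  rw [← Finset.sum_coe_sort, ← Equiv.sum_comp S.equivFin.symm]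

theorem exists_support_subset_product {M : Type*} [Zero M] (F : H × H →₀ M) :
    ∃ S : Finset H, F.support ⊆ S ×ˢ S := by
  classical
  refine ⟨F.support.image Prod.fst ∪ F.support.image Prod.snd, fun p hp => ?_⟩
  exact Finset.mem_product.2 ⟨Finset.mem_union_left _ (Finset.mem_image_of_mem _ hp),
    Finset.mem_union_right _ (Finset.mem_image_of_mem _ hp)⟩

/-- The quadratic form at the vector `c` of the scalar kernel obtained by evaluating at `z`. -/
def quad (z : Disc) (c : H → ℂ) : (H × H →₀ C(Disc, ℂ)) →ₗ[ℂ] ℂ :=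
  Finsupp.lsum ℂ fun p => (conj (c p.1) * c p.2) • (ContinuousMap.evalCLM ℂ z).toLinearMap

theorem quad_apply (z : Disc) (c : H → ℂ) (F : H × H →₀ C(Disc, ℂ)) :
    quad z c F = F.sum fun p f => conj (c p.1) * c p.2 * f z := rfl

theorem quad_single (z : Disc) (c : H → ℂ) (h k : H) (f : C(Disc, ℂ)) :
    quad z c (Finsupp.single (h, k) f) = conj (c h) * c k * f z := by
  rw [quad_apply, Finsupp.sum_single_index (by simp)]

theorem quad_eq_inner (z : Disc) (c : H → ℂ) (F : H × H →₀ C(Disc, ℂ)) {S : Finset H}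
    (hS : F.support ⊆ S ×ˢ S) : quad z c F =
      ⟪WithLp.toLp 2 (fun j => c (S.equivFin.symm j)),
        evalMat (Matrix.of fun j k => F (S.equivFin.symm j, S.equivFin.symm k)) z
          (WithLp.toLp 2 (fun j => c (S.equivFin.symm j)))⟫_ℂ := by
  rw [quad_apply, finsupp_sum_eq_sum_fin F hS _ (by simp), PiLp.inner_apply]
  refine Finset.sum_congr rfl fun j _ => ?_
  rw [evalMat_apply, RCLike.inner_apply, Finset.sum_mul]
  refine Finset.sum_congr rfl fun k _ => ?_
  simp only [Matrix.of_apply]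
  ring

/-- The cone of kernels whose values on the unit circle have positive semidefinite real part. -/
def posCone (H : Type u) : PointedCone ℝ (H × H →₀ C(Disc, ℂ)) where
  carrier := {F | ∀ z : Disc, ‖(z : ℂ)‖ = 1 → ∀ c, 0 ≤ (quad z c F).re}
  add_mem' hF hG z hz c := by
    rw [map_add, Complex.add_re]; exact add_nonneg (hF z hz c) (hG z hz c)
  zero_mem' z hz c := by simp
  smul_mem' r F hF z hz c := by
    have h : quad z c (r • F) = (r : ℝ) • quad z c F := by
      change quad z c ((r : ℝ) • F) = _
      rw [← Complex.coe_smul, map_smul, Complex.coe_smul]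
    rw [h, Complex.smul_re]
    exact mul_nonneg r.2 (hF z hz c)

variable (H) in
/-- The kernels with values in the Neil algebra. -/
def neilKernels : Submodule ℝ (H × H →₀ C(Disc, ℂ)) where
  carrier := {F | ∀ p, F p ∈ neilAlgebra}
  add_mem' hF hG p := add_mem (hF p) (hG p)
  zero_mem' p := zero_mem neilAlgebra
  smul_mem' r F hF p := by
    change r • F p ∈ neilAlgebra
    rw [← Complex.coe_smul]
    exact Subalgebra.smul_mem _ (hF p) _

theorem single_mem_neilKernels (p : H × H) (a : neilAlgebra) :
    Finsupp.single p (a : C(Disc, ℂ)) ∈ neilKernels H := by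
  classical
  intro q
  rw [Finsupp.single_apply]
  split_ifs
  exacts [a.2, zero_mem _]

/-- Every kernel is dominated by a Neil algebra valued kernel. -/
theorem exists_add_mem_posCone (F : H × H →₀ C(Disc, ℂ)) :
    ∃ G ∈ neilKernels H, G + F ∈ posCone H := by
  obtain ⟨S, hS⟩ := exists_support_subset_product F
  obtain ⟨C, hC0, hC⟩ := exists_norm_evalMat_le
    (Matrix.of fun j k => F (S.equivFin.symm j, S.equivFin.symm k))
  -- The constant `C` on the diagonal over `S` outweighs `F`, whose values have norm at most `C`.
  refine ⟨∑ h ∈ S, Finsupp.single (h, h) (((C : ℂ) • (1 : neilAlgebra) : neilAlgebra) : C(Disc, ℂ)),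
    sum_mem fun h _ => single_mem_neilKernels _ _, fun z hz c => ?_⟩
  set w : EuclideanSpace ℂ (Fin S.card) := WithLp.toLp 2 (fun j => c (S.equivFin.symm j)) with hw
  have h1 : quad z c (∑ h ∈ S, Finsupp.single (h, h)
      (((C : ℂ) • (1 : neilAlgebra) : neilAlgebra) : C(Disc, ℂ))) = ((C * ‖w‖ ^ 2 : ℝ) : ℂ) := by
    rw [map_sum, EuclideanSpace.norm_sq_eq, Finset.mul_sum, ← Finset.sum_coe_sort,
      ← Equiv.sum_comp S.equivFin.symm, Complex.ofReal_sum]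
    refine Finset.sum_congr rfl fun j _ => ?_
    rw [quad_single, Complex.conj_mul']
    simp [hw]
    ring
  rw [map_add, h1, quad_eq_inner z c F hS, Complex.add_re, Complex.ofReal_re]
  have h2 := (Complex.abs_re_le_norm _).trans ((norm_inner_le_norm (𝕜 := ℂ) w _).trans
    (mul_le_mul_of_nonneg_left ((evalMat _ z).le_of_opNorm_le (hC z) w) (norm_nonneg w)))
  have h3 := (abs_le.1 h2).1
  linarith [h3, show ‖w‖ * (C * ‖w‖) = C * ‖w‖ ^ 2 by ring]

end Kernels

/-! ### Extension of the positive functional -/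

section Functional

variable {H : Type u} [NormedAddCommGroup H] [InnerProductSpace ℂ H]

/-- The functional on kernels induced by a linear map into the operators on `H`. -/
def kernelForm (T : C(Disc, ℂ) →ₗ[ℂ] (H →L[ℂ] H)) : (H × H →₀ C(Disc, ℂ)) →ₗ[ℂ] ℂ :=
  Finsupp.lsum ℂ fun p => (innerSL ℂ p.1).toLinearMap ∘ₗ
    (ContinuousLinearMap.apply ℂ H p.2).toLinearMap ∘ₗ T

theorem kernelForm_apply (T : C(Disc, ℂ) →ₗ[ℂ] (H →L[ℂ] H)) (F : H × H →₀ C(Disc, ℂ)) :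
    kernelForm T F = F.sum fun p f => ⟪p.1, T f p.2⟫_ℂ := rfl

/-- Enumerating a finite set of vectors that carries the support turns the form into the quadratic
form of a block operator at the tuple of these vectors, where `re_inner_blockOp_nonneg` applies. -/
theorem re_kernelForm_nonneg {π : Rep H} (hu : IsUnital π) (hc : IsCompletelyContractive π)
    {T : C(Disc, ℂ) →ₗ[ℂ] (H →L[ℂ] H)} (hT : ∀ a : neilAlgebra, T a = π a)
    {F : H × H →₀ C(Disc, ℂ)} (hF : F ∈ neilKernels H) (hp : F ∈ posCone H) :
    0 ≤ (kernelForm T F).re := by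
  obtain ⟨S, hS⟩ := exists_support_subset_product F
  set G : Matrix (Fin S.card) (Fin S.card) neilAlgebra :=
    Matrix.of fun j k => ⟨F (S.equivFin.symm j, S.equivFin.symm k), hF _⟩ with hG
  have h := re_inner_blockOp_nonneg hu hc G (fun z hz c => ?_)
    (WithLp.toLp 2 fun j => (S.equivFin.symm j : H))
  · convert h using 2
    rw [kernelForm_apply, finsupp_sum_eq_sum_fin F hS _ (by simp), PiLp.inner_apply]
    refine Finset.sum_congr rfl fun j _ => ?_
    rw [blockOp_apply, inner_sum]
    refine Finset.sum_congr rfl fun k _ => ?_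
    rw [Matrix.map_apply, ← hT]
    rfl
  · have hinj : Function.Injective fun j => (S.equivFin.symm j : H) :=
      Subtype.val_injective.comp S.equivFin.symm.injective
    have h1 := hp z hz (Function.extend (fun j => (S.equivFin.symm j : H)) c 0)
    rw [quad_eq_inner z _ F hS] at h1
    simp only [hinj.extend_apply] at h1
    exact h1

/-- A unital completely contractive representation is induced by a positive functional on the
kernels with values in the continuous functions. -/
theorem exists_positive_functional {π : Rep H} (hu : IsUnital π)
    (hc : IsCompletelyContractive π) : ∃ Φ : (H × H →₀ C(Disc, ℂ)) →ₗ[ℂ] ℂ,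
      (∀ F ∈ posCone H, 0 ≤ (Φ F).re) ∧
      ∀ (h k : H) (a : neilAlgebra), Φ (Finsupp.single (h, k) (a : C(Disc, ℂ))) = ⟪h, π a k⟫_ℂ := by
  -- An arbitrary linear extension, with no continuity: it only makes `kernelForm` defined on all
  -- kernels, and only its values on the Neil algebra matter.
  obtain ⟨T, hT⟩ := LinearMap.exists_extend (p := Subalgebra.toSubmodule neilAlgebra)
    ({ toFun := fun a => π a, map_add' := map_add π, map_smul' := map_smul π } :
      neilAlgebra →ₗ[ℂ] (H →L[ℂ] H))
  have hT' : ∀ a : neilAlgebra, T a = π a := fun a => LinearMap.congr_fun hT a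
  obtain ⟨g, hg, hpos⟩ := riesz_extension (posCone H)
    ⟨neilKernels H, Complex.reLm ∘ₗ (kernelForm T).restrictScalars ℝ ∘ₗ (neilKernels H).subtype⟩
    (fun F hF => re_kernelForm_nonneg hu hc hT' F.2 hF)
    (fun F => by
      obtain ⟨G, hG, hGF⟩ := exists_add_mem_posCone F
      exact ⟨⟨G, hG⟩, hGF⟩)
  refine ⟨Module.Dual.extendRCLike g, fun F hF => ?_, fun h k a => ?_⟩
  · simpa [Module.Dual.extendRCLike_apply] using hpos F hF
  · have h1 : ∀ a : neilAlgebra, g (Finsupp.single (h, k) (a : C(Disc, ℂ))) =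
        (⟪h, π a k⟫_ℂ).re := by
      intro a
      rw [← hT']
      refine (hg ⟨_, single_mem_neilKernels _ a⟩).trans ?_
      change (kernelForm T (Finsupp.single (h, k) (a : C(Disc, ℂ)))).re = _
      rw [kernelForm_apply, Finsupp.sum_single_index (by simp)]
    -- The real functional `g` gives real parts only; its value at `I • a` supplies the imaginary
    -- part.
    have h2 := h1 (Complex.I • a)
    rw [Module.Dual.extendRCLike_apply, h1 a, Finsupp.smul_single]
    erw [h2]
    rw [map_smul, _root_.smul_apply, inner_smul_right]
    apply Complex.ext <;> simp

end Functional

/-- The Hilbert space completion of a semi-inner product space. -/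
theorem exists_hilbert_of_core {X : Type u} [AddCommGroup X] [Module ℂ X]
    (c : PreInnerProductSpace.Core ℂ X) :
    ∃ (K : Type u) (_ : NormedAddCommGroup K) (_ : InnerProductSpace ℂ K) (_ : CompleteSpace K)
      (ι : X →ₗ[ℂ] K), DenseRange ι ∧ ∀ x y, ⟪ι x, ι y⟫_ℂ = c.inner x y := by
  let : SeminormedAddCommGroup X := @InnerProductSpace.Core.toSeminormedAddCommGroup ℂ X _ _ _ c
  let : InnerProductSpace ℂ X := InnerProductSpace.ofCore c
  refine ⟨UniformSpace.Completion X, inferInstance, inferInstance, inferInstance,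
    (UniformSpace.Completion.toComplₗᵢ (𝕜 := ℂ) (E := X)).toLinearMap,
    UniformSpace.Completion.denseRange_coe, fun x y => ?_⟩
  exact UniformSpace.Completion.inner_coe x y

/-! ### The GNS construction on formal vectors -/

section FormalVectors

variable {H : Type u}

/-- The rank one kernel of two formal vectors. -/
def rankOneKernel (x y : H →₀ C(Disc, ℂ)) : H × H →₀ C(Disc, ℂ) :=
  Finsupp.onFinset (x.support ×ˢ y.support) (fun p => star (x p.1) * y p.2) fun p hp => by
    rw [Finset.mem_product, Finsupp.mem_support_iff, Finsupp.mem_support_iff]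
    refine ⟨fun h => hp ?_, fun h => hp ?_⟩ <;> simp [h]

theorem rankOneKernel_apply (x y : H →₀ C(Disc, ℂ)) (p : H × H) :
    rankOneKernel x y p = star (x p.1) * y p.2 := rfl

/-- Evaluation of a formal vector at a point of the disc and a function on `H`. -/
def evalVec (z : Disc) (c : H → ℂ) : (H →₀ C(Disc, ℂ)) →ₗ[ℂ] ℂ :=
  Finsupp.lsum ℂ fun h => c h • (ContinuousMap.evalCLM ℂ z).toLinearMap

theorem evalVec_apply (z : Disc) (c : H → ℂ) (x : H →₀ C(Disc, ℂ)) :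
    evalVec z c x = x.sum fun h f => c h * f z := rfl

theorem evalVec_smul (z : Disc) (c : H → ℂ) (f : C(Disc, ℂ)) (x : H →₀ C(Disc, ℂ)) :
    evalVec z c (f • x) = f z * evalVec z c x := by
  rw [evalVec_apply, Finsupp.sum_smul_index (by simp), evalVec_apply, Finsupp.sum,
    Finsupp.sum, Finset.mul_sum]
  refine Finset.sum_congr rfl fun h _ => ?_
  rw [ContinuousMap.mul_apply]
  ring

theorem quad_rankOneKernel (z : Disc) (c : H → ℂ) (x y : H →₀ C(Disc, ℂ)) :
    quad z c (rankOneKernel x y) = conj (evalVec z c x) * evalVec z c y := by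
  rw [quad_apply, Finsupp.sum_of_support_subset (rankOneKernel x y)
    (s := x.support ×ˢ y.support) Finsupp.support_onFinset_subset _ (by simp),
    Finset.sum_product, evalVec_apply, evalVec_apply, Finsupp.sum, Finsupp.sum, map_sum,
    Finset.sum_mul]
  refine Finset.sum_congr rfl fun h _ => ?_
  rw [Finset.mul_sum]
  refine Finset.sum_congr rfl fun k _ => ?_
  rw [rankOneKernel_apply, ContinuousMap.mul_apply, ContinuousMap.star_apply, map_mul]
  simp only [RCLike.star_def]
  ring

variable {Φ : (H × H →₀ C(Disc, ℂ)) →ₗ[ℂ] ℂ}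

/-- Both `F` and `-F` lie in the cone. -/
theorem re_eq_zero_of_re_quad_eq_zero (hΦ : ∀ F ∈ posCone H, 0 ≤ (Φ F).re)
    {F : H × H →₀ C(Disc, ℂ)} (hF : ∀ z : Disc, ‖(z : ℂ)‖ = 1 → ∀ c, (quad z c F).re = 0) :
    (Φ F).re = 0 := by
  refine le_antisymm ?_ (hΦ F fun z hz c => (hF z hz c).ge)
  have h := hΦ (-F) fun z hz c => by rw [map_neg, Complex.neg_re, hF z hz c, neg_zero]
  rw [map_neg, Complex.neg_re] at h
  linarith

/-- Apply the previous lemma to `F - G` and to `I • (F - G)`. It makes `Φ` blind to values off the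
circle, so relations valid only on the circle pass to the GNS space. -/
theorem eq_of_quad_eq (hΦ : ∀ F ∈ posCone H, 0 ≤ (Φ F).re) {F G : H × H →₀ C(Disc, ℂ)}
    (h : ∀ z : Disc, ‖(z : ℂ)‖ = 1 → ∀ c, quad z c F = quad z c G) : Φ F = Φ G := by
  have h1 := re_eq_zero_of_re_quad_eq_zero hΦ (F := F - G) fun z hz c => by
    rw [map_sub, h z hz c, sub_self, Complex.zero_re]
  have h2 := re_eq_zero_of_re_quad_eq_zero hΦ (F := Complex.I • (F - G)) fun z hz c => by
    rw [map_smul, map_sub, h z hz c, sub_self, smul_zero, Complex.zero_re]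
  rw [← sub_eq_zero, ← map_sub]
  apply Complex.ext
  · exact h1
  · simp at h2 ⊢
    linarith

/-- The difference of the two kernels, and `I` times their sum, have purely imaginary quadratic
forms. -/
theorem conj_rankOneKernel (hΦ : ∀ F ∈ posCone H, 0 ≤ (Φ F).re) (x y : H →₀ C(Disc, ℂ)) :
    conj (Φ (rankOneKernel y x)) = Φ (rankOneKernel x y) := by
  have h1 := re_eq_zero_of_re_quad_eq_zero hΦ (F := rankOneKernel x y - rankOneKernel y x)
    fun z _ c => by
      rw [map_sub, quad_rankOneKernel, quad_rankOneKernel]; simp; ring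
  have h2 := re_eq_zero_of_re_quad_eq_zero hΦ
    (F := Complex.I • (rankOneKernel x y + rankOneKernel y x)) fun z _ c => by
      rw [map_smul, map_add, quad_rankOneKernel, quad_rankOneKernel]; simp; ring
  rw [map_sub, Complex.sub_re] at h1
  rw [map_smul, map_add] at h2
  apply Complex.ext
  · rw [Complex.conj_re]; linarith
  · simp at h2
    rw [Complex.conj_im]; linarith

/-- The semi-inner product on formal vectors given by a positive functional on kernels. -/
abbrev kernelCore (hΦ : ∀ F ∈ posCone H, 0 ≤ (Φ F).re) :
    PreInnerProductSpace.Core ℂ (H →₀ C(Disc, ℂ)) where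
  inner x y := Φ (rankOneKernel x y)
  conj_inner_symm := conj_rankOneKernel hΦ
  re_inner_nonneg x := hΦ _ fun z _ c => by
    rw [quad_rankOneKernel, Complex.conj_mul']
    norm_cast
    positivity
  add_left x y w := by
    rw [← map_add]
    congr 1
    ext1 p
    simp only [rankOneKernel_apply, Finsupp.add_apply, star_add, add_mul]
  smul_left x y r := by
    rw [← smul_eq_mul, ← map_smul]
    congr 1
    ext1 p
    simp only [rankOneKernel_apply, Finsupp.smul_apply, star_smul, smul_mul_assoc]
    rfl

variable {K : Type v} [NormedAddCommGroup K] [InnerProductSpace ℂ K]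
  {ι : (H →₀ C(Disc, ℂ)) →ₗ[ℂ] K}

theorem norm_sq_eq_re_rankOneKernel (hι : ∀ x y, ⟪ι x, ι y⟫_ℂ = Φ (rankOneKernel x y))
    (x : H →₀ C(Disc, ℂ)) : ‖ι x‖ ^ 2 = (Φ (rankOneKernel x x)).re := by
  rw [← hι, ← inner_self_eq_norm_sq (𝕜 := ℂ)]
  rfl

/-- Matrices of continuous functions act on formal vectors with norm at most the supremum of
their norms on the unit circle. -/
theorem sum_norm_sq_le (hΦ : ∀ F ∈ posCone H, 0 ≤ (Φ F).re)
    (hι : ∀ x y, ⟪ι x, ι y⟫_ℂ = Φ (rankOneKernel x y)) {n : ℕ}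
    (F : Matrix (Fin n) (Fin n) C(Disc, ℂ)) {m : ℝ}
    (hF : ∀ z : Disc, ‖(z : ℂ)‖ = 1 → ‖evalMat F z‖ ≤ m) (x : Fin n → H →₀ C(Disc, ℂ)) :
    ∑ j, ‖ι (∑ k, F j k • x k)‖ ^ 2 ≤ m ^ 2 * ∑ k, ‖ι (x k)‖ ^ 2 := by
  -- At `(z, c)` this kernel has quadratic form `m²‖w‖² - ‖F(z) w‖²`, where `w` is the tuple of
  -- values of the `x k`; so it lies in the cone.
  have h := hΦ (((m ^ 2 : ℝ) : ℂ) • ∑ k, rankOneKernel (x k) (x k) -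
    ∑ j, rankOneKernel (∑ k, F j k • x k) (∑ k, F j k • x k)) fun z hz c => ?_
  · rw [map_sub, map_smul, map_sum, map_sum, Complex.sub_re, smul_eq_mul, Complex.re_ofReal_mul,
      Complex.re_sum, Complex.re_sum] at h
    simp only [norm_sq_eq_re_rankOneKernel hι]
    linarith
  · set w : EuclideanSpace ℂ (Fin n) := WithLp.toLp 2 fun k => evalVec z c (x k) with hw
    have h1 : ∀ j, evalVec z c (∑ k, F j k • x k) = evalMat F z w j := by
      intro j
      rw [map_sum, evalMat_apply]
      simp only [evalVec_smul, hw]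
    have h2 : ‖evalMat F z w‖ ^ 2 ≤ (m * ‖w‖) ^ 2 := by
      gcongr
      exact (evalMat F z).le_of_opNorm_le (hF z hz) w
    rw [mul_pow, EuclideanSpace.norm_sq_eq, EuclideanSpace.norm_sq_eq] at h2
    rw [map_sub, map_smul, map_sum, map_sum, Complex.sub_re, smul_eq_mul, Complex.re_ofReal_mul,
      Complex.re_sum, Complex.re_sum]
    simp only [quad_rankOneKernel, h1, Complex.conj_mul', ← Complex.ofReal_pow, Complex.ofReal_re]
    linarith

theorem norm_smul_formal_le (hΦ : ∀ F ∈ posCone H, 0 ≤ (Φ F).re)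
    (hι : ∀ x y, ⟪ι x, ι y⟫_ℂ = Φ (rankOneKernel x y)) (f : C(Disc, ℂ))
    (x : H →₀ C(Disc, ℂ)) : ‖ι (f • x)‖ ≤ ‖f‖ * ‖ι x‖ := by
  have h := sum_norm_sq_le hΦ hι (n := 1) (Matrix.of fun _ _ => f) (m := ‖f‖)
    (fun z _ => ContinuousLinearMap.opNorm_le_bound _ (norm_nonneg _) fun c => ?_) (fun _ => x)
  · simp only [Finset.univ_unique, Finset.sum_singleton, Matrix.of_apply, ← mul_pow] at h
    exact le_of_sq_le_sq h (by positivity)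
  · rw [EuclideanSpace.norm_eq, EuclideanSpace.norm_eq]
    simp only [Finset.univ_unique, Finset.sum_singleton, evalMat_apply, Matrix.of_apply, norm_mul]
    rw [Real.sqrt_sq (by positivity), Real.sqrt_sq (by positivity)]
    gcongr
    exact f.norm_coe_le_norm z

/-- Multiplication by `f` is bounded for the GNS norm, hence extends from the dense range of `ι`;
the algebraic identities are checked on that range. The adjoint relation holds because moving `f`
across the inner product leaves the quadratic form unchanged. -/
theorem exists_starAlgHom [CompleteSpace K] (hΦ : ∀ F ∈ posCone H, 0 ≤ (Φ F).re)
    (hι : ∀ x y, ⟪ι x, ι y⟫_ℂ = Φ (rankOneKernel x y)) (hd : DenseRange ι) :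
    ∃ ρ : C(Disc, ℂ) →⋆ₐ[ℂ] (K →L[ℂ] K), ∀ f x, ρ f (ι x) = ι (f • x) := by
  set R : C(Disc, ℂ) → K →L[ℂ] K := fun f =>
    (ι ∘ₗ DistribSMul.toLinearMap ℂ (H →₀ C(Disc, ℂ)) f).extendOfNorm ι with hR
  have hRι : ∀ f x, R f (ι x) = ι (f • x) := fun f x =>
    LinearMap.extendOfNorm_eq hd ⟨‖f‖, norm_smul_formal_le hΦ hι f⟩ x
  have hext : ∀ A B : K →L[ℂ] K, (∀ x, A (ι x) = B (ι x)) → A = B := fun A B h =>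
    DFunLike.coe_injective (hd.equalizer A.continuous B.continuous (funext h))
  refine ⟨{ toFun := R, map_one' := ?_, map_mul' := ?_, map_zero' := ?_, map_add' := ?_,
            commutes' := ?_, map_star' := ?_ }, hRι⟩
  · exact hext _ _ fun x => by rw [hRι, one_smul]; rfl
  · exact fun f g => hext _ _ fun x => by
      rw [hRι, mul_smul, ← hRι, ← hRι]; rfl
  · exact hext _ _ fun x => by rw [hRι, zero_smul, map_zero]; rfl
  · exact fun f g => hext _ _ fun x => by
      rw [hRι, add_smul, map_add, ← hRι, ← hRι]; rfl
  · intro r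
    refine hext _ _ fun x => ?_
    change R _ (ι x) = (algebraMap ℂ (K →L[ℂ] K) r) (ι x)
    rw [hRι, Algebra.algebraMap_eq_smul_one, Algebra.algebraMap_eq_smul_one, smul_assoc, one_smul,
      map_smul]
    rfl
  · intro f
    change R (star f) = ContinuousLinearMap.adjoint (R f)
    rw [ContinuousLinearMap.eq_adjoint_iff]
    intro x y
    refine hd.induction_on₂ (p := fun x y => ⟪R (star f) x, y⟫_ℂ = ⟪x, R f y⟫_ℂ)
      (isClosed_eq (by fun_prop) (by fun_prop)) (fun a b => ?_) x y
    rw [hRι, hRι, hι, hι]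
    refine eq_of_quad_eq hΦ fun z _ c => ?_
    rw [quad_rankOneKernel, quad_rankOneKernel, evalVec_smul, evalVec_smul]
    simp
    ring

end FormalVectors

/-! ### Dilation and extremality -/

section Dilation

variable {H : Type u} [NormedAddCommGroup H] [InnerProductSpace ℂ H] [CompleteSpace H]

/-- A unital, extremal, completely contractive representation of the Neil algebra is the
restriction to an invariant subspace of a representation of the continuous functions that only
depends on the values on the circle. -/
theorem exists_extension {π : Rep H} (hu : IsUnital π) (hc : IsCompletelyContractive π)
    (he : IsExtremal π) :
    ∃ (K : Type u) (_ : NormedAddCommGroup K) (_ : InnerProductSpace ℂ K) (_ : CompleteSpace K)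
      (ρ : C(Disc, ℂ) →⋆ₐ[ℂ] (K →L[ℂ] K)) (V : H →ₗᵢ[ℂ] K),
      (∀ f : C(Disc, ℂ), (∀ z : Disc, ‖(z : ℂ)‖ = 1 → f z = 0) → ρ f = 0) ∧
      ∀ (a : neilAlgebra) (h : H), V (π a h) = ρ a (V h) := by
  obtain ⟨Φ, hΦ, hΦπ⟩ := exists_positive_functional hu hc
  obtain ⟨K, _, _, _, ι, hd, hι⟩ := exists_hilbert_of_core (kernelCore hΦ)
  replace hι : ∀ x y, ⟪ι x, ι y⟫_ℂ = Φ (rankOneKernel x y) := hι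
  obtain ⟨ρ, hρ⟩ := exists_starAlgHom hΦ hι hd
  have hker : ∀ (h k : H) (a : neilAlgebra),
      ⟪ι (Finsupp.single h 1), ι ((a : C(Disc, ℂ)) • Finsupp.single k 1)⟫_ℂ = ⟪h, π a k⟫_ℂ := by
    classical
    intro h k a
    rw [hι, ← hΦπ]
    congr 1
    ext1 p
    rw [rankOneKernel_apply, Finsupp.smul_apply, Finsupp.single_apply, Finsupp.single_apply,
      Finsupp.single_apply]
    rcases eq_or_ne h p.1 with h1 | h1 <;> rcases eq_or_ne k p.2 with h2 | h2 <;>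
      simp [h1, h2, Prod.ext_iff]
  have hker1 : ∀ h k : H, ⟪ι (Finsupp.single h 1), ι (Finsupp.single k 1)⟫_ℂ = ⟪h, k⟫_ℂ := by
    intro h k
    have h1 := hker h k 1
    have h2 : π 1 = 1 := hu
    rw [h2, OneMemClass.coe_one, one_smul] at h1
    exact h1
  -- The formal vector at `h` is not additive in `h`; additivity holds in `K` because the Gram
  -- matrix `hker1` gives the defect norm zero.
  have hadd : ∀ h k : H, ι (Finsupp.single (h + k) 1) =
      ι (Finsupp.single h 1) + ι (Finsupp.single k 1) := by
    intro h k
    rw [← sub_eq_zero, ← inner_self_eq_zero (𝕜 := ℂ)]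
    simp only [inner_sub_left, inner_sub_right, inner_add_left, inner_add_right, hker1]
    ring
  have hsmul : ∀ (r : ℂ) (h : H), ι (Finsupp.single (r • h) 1) = r • ι (Finsupp.single h 1) := by
    intro r h
    rw [← sub_eq_zero, ← inner_self_eq_zero (𝕜 := ℂ)]
    simp only [inner_sub_left, inner_sub_right, inner_smul_left, inner_smul_right, hker1]
    ring
  let V : H →ₗᵢ[ℂ] K := LinearMap.isometryOfInner
    { toFun := fun h => ι (Finsupp.single h 1), map_add' := hadd, map_smul' := hsmul } hker1
  have hV : ∀ h, V h = ι (Finsupp.single h 1) := fun h => rfl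
  let ρA : Rep K := (ρ.toAlgHom.comp neilAlgebra.val : neilAlgebra →ₐ[ℂ] (K →L[ℂ] K))
  have hρA : ∀ a : neilAlgebra, ρA a = ρ a := fun a => rfl
  have hcc : IsCompletelyContractive ρA := by
    intro n F
    have hm : 0 ≤ matNorm F := Real.iSup_nonneg fun z => norm_nonneg _
    refine ContinuousLinearMap.opNorm_le_bound _ hm fun x => ?_
    have hdn : DenseRange fun y : Fin n → H →₀ C(Disc, ℂ) =>
        (WithLp.toLp 2 fun j => ι (y j) : PiLp 2 fun _ : Fin n => K) :=
      (PiLp.continuousLinearEquiv 2 ℂ (fun _ : Fin n => K)).symm.surjective.denseRange.comp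
        (DenseRange.piMap fun _ => hd) (PiLp.continuousLinearEquiv 2 ℂ _).symm.continuous
    refine hdn.induction_on (p := fun x => ‖blockOp (F.map ρA) x‖ ≤ matNorm F * ‖x‖) x
      (isClosed_le (by fun_prop) (by fun_prop)) fun y => ?_
    refine le_of_sq_le_sq ?_ (by positivity)
    rw [mul_pow, PiLp.norm_sq_eq_of_L2, PiLp.norm_sq_eq_of_L2]
    refine le_trans (le_of_eq ?_) (sum_norm_sq_le hΦ hι (toMat F)
      (fun z _ => norm_evalMat_le_matNorm F z) y)
    refine Finset.sum_congr rfl fun j _ => ?_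
    rw [blockOp_apply, map_sum]
    simp only [Matrix.map_apply, hρA, hρ]
  refine ⟨K, inferInstance, inferInstance, inferInstance, ρ, V, fun f hf => ?_, fun a h => ?_⟩
  · refine DFunLike.coe_injective (hd.equalizer (ρ f).continuous continuous_const ?_)
    funext x
    change ρ f (ι x) = 0
    rw [hρ, ← inner_self_eq_zero (𝕜 := ℂ), hι]
    refine (eq_of_quad_eq hΦ (G := 0) fun z hz c => ?_).trans (map_zero Φ)
    rw [quad_rankOneKernel, evalVec_smul, hf z hz]
    simp
  -- Extremality upgrades the compression identity `hker` to an intertwining relation.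
  · refine DFunLike.congr_fun (he K ρA V hcc (fun b => ?_) a) h
    ext1 k
    refine ext_inner_left ℂ fun l => ?_
    change _ = ⟪l, ContinuousLinearMap.adjoint V.toContinuousLinearMap (ρ b (V k))⟫_ℂ
    rw [ContinuousLinearMap.adjoint_inner_right]
    change _ = ⟪V l, ρ b (V k)⟫_ℂ
    rw [hV, hV, hρ, hker]

end Dilation

theorem isClosed_H2 : IsClosed (H2 : Set L2) := by
  have : (H2 : Set L2) = ⋂ n : ℤ, ⋂ _ : n < 0, {f | ⟪fourierLp (T := 1) 2 n, f⟫_ℂ = 0} := by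
    ext f
    simp only [Set.mem_iInter]
    rfl
  rw [this]
  exact isClosed_iInter fun n => isClosed_iInter fun _ => isClosed_eq (by fun_prop) (by fun_prop)

/-! ### Unitary powers, wandering vectors and the shift -/

section Shift

variable {K : Type u} [NormedAddCommGroup K] [InnerProductSpace ℂ K] [CompleteSpace K]

/-- The integer powers of a unitary operator. -/
def upow (U : unitary (K →L[ℂ] K)) (n : ℤ) : K →L[ℂ] K := (U ^ n : unitary (K →L[ℂ] K))

variable (U : unitary (K →L[ℂ] K))

theorem upow_zero (x : K) : upow U 0 x = x := by simp [upow]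

theorem upow_one : upow U 1 = (U : K →L[ℂ] K) := by simp [upow]

theorem upow_add (m n : ℤ) (x : K) : upow U (m + n) x = upow U m (upow U n x) := by
  simp [upow, zpow_add]

theorem upow_neg_upow (n : ℤ) (x : K) : upow U (-n) (upow U n x) = x := by
  rw [← upow_add, neg_add_cancel, upow_zero]

theorem inner_upow_left (n : ℤ) (x y : K) : ⟪upow U n x, y⟫_ℂ = ⟪x, upow U (-n) y⟫_ℂ := by
  have h : upow U (-n) = ContinuousLinearMap.adjoint (upow U n) := by
    rw [upow, zpow_neg, ← Unitary.star_eq_inv]; rfl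
  rw [h, ContinuousLinearMap.adjoint_inner_right]

variable {U} {M : Submodule ℂ K}

theorem upow_mem (hU : ∀ x ∈ M, upow U 1 x ∈ M) (n : ℕ) {x : K} (hx : x ∈ M) :
    upow U n x ∈ M := by
  induction n with
  | zero => rwa [Nat.cast_zero, upow_zero]
  | succ n ih =>
    rw [Nat.cast_succ, add_comm, upow_add]
    exact hU _ ih

/-- Powers of a unitary take orthogonal wandering vectors to orthogonal vectors. -/
theorem inner_upow_wandering (hU : ∀ x ∈ M, upow U 1 x ∈ M) {e e' : K} (he : e ∈ M)
    (he' : e' ∈ M) (hw : ∀ y ∈ M, ⟪upow U 1 y, e⟫_ℂ = 0) (hw' : ∀ y ∈ M, ⟪upow U 1 y, e'⟫_ℂ = 0)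
    {n : ℤ} (hn : n ≠ 0) : ⟪upow U n e, e'⟫_ℂ = 0 := by
  rcases lt_or_gt_of_ne hn with h | h
  · obtain ⟨k, rfl⟩ : ∃ k : ℕ, n = -(1 + k) := ⟨(-n - 1).toNat, by omega⟩
    rw [inner_upow_left, neg_neg, ← inner_conj_symm, upow_add, hw _ (upow_mem hU k he'), map_zero]
  · obtain ⟨k, rfl⟩ : ∃ k : ℕ, n = 1 + k := ⟨(n - 1).toNat, by omega⟩
    rw [upow_add]
    exact hw' _ (upow_mem hU k he)

/-- A vector of `M` orthogonal to `M ⊖ U M` lies in `U M`: split `x = p + q` along the closed space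
`U M`, written as a preimage under `U⁻¹`. Then `q` is wandering and `⟪q, x⟫ = ‖q‖²`, so `q = 0`. -/
theorem exists_sub_wandering (hM : IsClosed (M : Set K)) {x : K} (hx : x ∈ M)
    (hU : ∀ x ∈ M, upow U 1 x ∈ M)
    (hl : ∀ l ∈ M, (∀ y ∈ M, ⟪upow U 1 y, l⟫_ℂ = 0) → ⟪l, x⟫_ℂ = 0) : upow U (-1) x ∈ M := by
  set N : Submodule ℂ K := M.comap (upow U (-1)).toLinearMap with hN
  have hNc : IsClosed (N : Set K) := hM.preimage (upow U (-1)).continuous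
  have : CompleteSpace N := hNc.completeSpace_coe
  obtain ⟨p, hp, q, hq, rfl⟩ := N.exists_add_mem_mem_orthogonal x
  rw [Submodule.mem_orthogonal] at hq
  have hpM : p ∈ M := by
    have h := hU _ (show upow U (-1) p ∈ M from hp)
    rwa [← upow_add, add_neg_cancel, upow_zero] at h
  have hqM : q ∈ M := by simpa using M.sub_mem hx hpM
  have h1 := hl q hqM fun y hy => hq _ (by
    change upow U (-1) (upow U 1 y) ∈ M
    rwa [upow_neg_upow])
  rw [inner_add_right, ← inner_conj_symm, hq p hp, map_zero, zero_add, inner_self_eq_zero] at h1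
  rw [h1, add_zero]
  exact hp

/-- A pure isometry with one-dimensional wandering subspace is a unilateral shift. -/
theorem exists_shift_model (hM : IsClosed (M : Set K)) (hM0 : M ≠ ⊥)
    (hU : ∀ x ∈ M, upow U 1 x ∈ M)
    (hR : ∀ x, (∀ n : ℕ, upow U (-n) x ∈ M) → x = 0)
    (hL : ∀ e ∈ M, ∀ e' ∈ M, (∀ y ∈ M, ⟪upow U 1 y, e⟫_ℂ = 0) →
      (∀ y ∈ M, ⟪upow U 1 y, e'⟫_ℂ = 0) → ⟪e, e'⟫_ℂ = 0 → e = 0 ∨ e' = 0) :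
    ∃ J : L2 →ₗᵢ[ℂ] K,
      (∀ n : ℤ, upow U 1 (J (fourierLp 2 n)) = J (fourierLp 2 (n + 1))) ∧
      ∀ x, x ∈ M ↔ ∃ f ∈ H2, J f = x := by
  classical
  obtain ⟨e, heM, hew, he1⟩ : ∃ e ∈ M, (∀ y ∈ M, ⟪upow U 1 y, e⟫_ℂ = 0) ∧ ‖e‖ = 1 := by
    -- Without wandering vectors `U M = M`, so every `U⁻ⁿ x` stays in `M`, contradicting `hR` and `M
    -- ≠ ⊥`.
    by_contra! hcon
    refine hM0 ((Submodule.eq_bot_iff M).2 fun x hx => hR x fun n => ?_)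
    induction n with
    | zero => simpa [upow_zero] using hx
    | succ n ih =>
      rw [Nat.cast_succ, neg_add_rev, upow_add]
      refine exists_sub_wandering hM ih hU fun l hl hlw => ?_
      have hl0 : l = 0 := by
        by_contra hl0
        refine hcon ((‖l‖⁻¹ : ℂ) • l) (M.smul_mem _ hl) (fun y hy => ?_) ?_
        · rw [inner_smul_right, hlw y hy, mul_zero]
        · simp [norm_smul, hl0]
      rw [hl0, inner_zero_left]
  have he0 : e ≠ 0 := by
    rintro rfl
    simp at he1
  have hon : Orthonormal ℂ fun n : ℤ => upow U n e := by
    rw [orthonormal_iff_ite]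
    intro m n
    rw [← neg_neg n, ← inner_upow_left, ← upow_add]
    split_ifs with h
    · rw [h, neg_neg, neg_add_cancel, upow_zero, inner_self_eq_norm_sq_to_K, he1]
      simp
    · exact inner_upow_wandering hU heM heM hew hew (by omega)
  let J : L2 →ₗᵢ[ℂ] K := hon.orthogonalFamily.linearIsometry.comp
    (fourierBasis (T := 1)).repr.toLinearIsometry
  have hJ : ∀ n : ℤ, J (fourierLp 2 n) = upow U n e := by
    intro n
    change hon.orthogonalFamily.linearIsometry ((fourierBasis (T := 1)).repr (fourierLp 2 n)) = _
    rw [← coe_fourierBasis, HilbertBasis.repr_self, OrthogonalFamily.linearIsometry_apply_single]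
    simp
  have hJM : ∀ f ∈ H2, J f ∈ M := by
    intro f hf
    have h := ((fourierBasis (T := 1)).hasSum_repr f).mapL J.toContinuousLinearMap
    refine hM.mem_of_tendsto h (Filter.Eventually.of_forall fun s => sum_mem fun n _ => ?_)
    rw [map_smul, HilbertBasis.repr_apply_apply, coe_fourierBasis]
    rcases lt_or_ge n 0 with hn | hn
    · rw [hf n hn, zero_smul]
      exact M.zero_mem
    · obtain ⟨k, rfl⟩ := Int.eq_ofNat_of_zero_le hn
      change _ • J (fourierLp 2 (k : ℤ)) ∈ M
      rw [hJ]
      exact M.smul_mem _ (upow_mem hU k heM)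
  refine ⟨J, fun n => ?_, fun x => ⟨fun hx => ?_, ?_⟩⟩
  · rw [hJ, hJ, add_comm, upow_add]
  · have : CompleteSpace (H2.map J.toLinearMap) :=
      (J.isometry.isClosedEmbedding.isClosedMap _ isClosed_H2).completeSpace_coe
    obtain ⟨_, ⟨f, hf, rfl⟩, q, hq, rfl⟩ :=
      (H2.map J.toLinearMap).exists_add_mem_mem_orthogonal x
    have hqM : q ∈ M := by simpa using M.sub_mem hx (hJM f hf)
    rw [Submodule.mem_orthogonal] at hq
    have hq1 : ∀ k : ℕ, ⟪upow U k e, q⟫_ℂ = 0 := by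
      intro k
      rw [← hJ]
      refine hq _ ⟨_, fun n hn => ?_, rfl⟩
      exact orthonormal_fourier.2 (by omega)
    have hq0 : q = 0 := by
      refine hR q fun n => ?_
      -- The orthogonality to all `Uᵏ e` is carried along: it is what allows each further division
      -- by `U`.
      suffices h : upow U (-n) q ∈ M ∧ ∀ k : ℕ, ⟪upow U k e, upow U (-n) q⟫_ℂ = 0 from h.1
      induction n with
      | zero => simpa [upow_zero] using ⟨hqM, hq1⟩
      | succ n ih =>
        rw [Nat.cast_succ, neg_add_rev, upow_add]
        refine ⟨exists_sub_wandering hM ih.1 hU fun l hl hlw => ?_, fun k => ?_⟩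
        -- The part of `l` orthogonal to `e` is again wandering, so `hL` kills it and `l` is a
        -- multiple of `e`.
        · have h := hL e heM (l - ⟪e, l⟫_ℂ • e) (M.sub_mem hl (M.smul_mem _ heM)) hew
            (fun y hy => by rw [inner_sub_right, inner_smul_right, hlw y hy, hew y hy]; simp)
            (by
              rw [inner_sub_right, inner_smul_right, inner_self_eq_norm_sq_to_K, he1]
              simp)
          have h2 := ih.2 0
          rw [Nat.cast_zero, upow_zero] at h2
          rw [sub_eq_zero.1 (h.resolve_left he0), inner_smul_left, h2, mul_zero]
        · rw [← inner_upow_left, ← upow_add, add_comm]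
          exact_mod_cast ih.2 (k + 1)
    exact ⟨f, hf, by rw [hq0, add_zero]; rfl⟩
  · rintro ⟨f, hf, rfl⟩
    exact hJM f hf

end Shift

/-! ### Multiplication operators and representations of the continuous functions -/

section Multiplication

theorem mulL2_add (g g' : C(UnitAddCircle, ℂ)) (f : L2) :
    mulL2 (g + g') f = mulL2 g f + mulL2 g' f := by simp [mulL2]

theorem mulL2_const (r : ℂ) (f : L2) : mulL2 (ContinuousMap.const _ r) f = r • f := by
  refine Lp.ext ?_
  filter_upwards [coeFn_mulL2 (ContinuousMap.const _ r) f, Lp.coeFn_smul r f] with t h1 h2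
  rw [h1, h2]
  rfl

theorem continuous_mulL2 (f : L2) : Continuous fun g : C(UnitAddCircle, ℂ) => mulL2 g f := by
  unfold mulL2
  fun_prop

theorem mulL2_fourier (m n : ℤ) :
    mulL2 (fourier m) (fourierLp 2 n) = fourierLp (T := 1) 2 (m + n) := by
  refine Lp.ext ?_
  filter_upwards [coeFn_mulL2 (fourier m) (fourierLp 2 n), coeFn_fourierLp (T := 1) 2 n,
    coeFn_fourierLp (T := 1) 2 (m + n)] with t h1 h2 h3
  rw [h1, h2, h3, fourier_add]

theorem bdry_coord : bdry coord = fourier 1 := rfl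

theorem star_coord_mul_coord {z : Disc} (hz : ‖(z : ℂ)‖ = 1) :
    (star coord * coord) z = 1 := by
  rw [ContinuousMap.mul_apply, ContinuousMap.star_apply, coord_apply]
  simp [Complex.conj_mul', hz]

theorem bdry_star_coord_mul_coord : bdry (star coord) * bdry coord = 1 := by
  ext1 t
  refine star_coord_mul_coord (z := circ t) ?_
  simp [circ, fourier_apply, Circle.norm_coe]

end Multiplication

section Representation

variable {K : Type u} [NormedAddCommGroup K] [InnerProductSpace ℂ K] [CompleteSpace K]
  (ρ : C(Disc, ℂ) →⋆ₐ[ℂ] (K →L[ℂ] K))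

theorem continuous_starAlgHom : Continuous ρ :=
  AddMonoidHomClass.continuous_of_bound ρ 1 fun f => by
    rw [one_mul]
    exact NonUnitalStarAlgHom.norm_apply_le (ρ : C(Disc, ℂ) →⋆ₙₐ[ℂ] (K →L[ℂ] K)) f

theorem continuous_starAlgHom_apply (x : K) : Continuous fun f => ρ f x :=
  (ContinuousLinearMap.apply ℂ K x).continuous.comp (continuous_starAlgHom ρ)

theorem starAlgHom_mul_apply (f g : C(Disc, ℂ)) (x : K) : ρ (f * g) x = ρ f (ρ g x) := by
  rw [map_mul]; rfl

theorem inner_starAlgHom_left (f : C(Disc, ℂ)) (x y : K) :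
    ⟪ρ f x, y⟫_ℂ = ⟪x, ρ (star f) y⟫_ℂ := by
  rw [map_star, ContinuousLinearMap.star_eq_adjoint, ContinuousLinearMap.adjoint_inner_right]

/-- A closed subspace that reduces the coordinate function reduces the representation. -/
theorem starAlgHom_mem {P : Submodule ℂ K} (hP : IsClosed (P : Set K))
    (h1 : ∀ x ∈ P, ρ coord x ∈ P) (h2 : ∀ x ∈ P, ρ (star coord) x ∈ P) (f : C(Disc, ℂ)) :
    ∀ x ∈ P, ρ f x ∈ P := by
  induction f using ContinuousMap.induction_on_of_compact with
  | const r =>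
    intro x hx
    have h : ρ (ContinuousMap.const _ r) x = r • x :=
      DFunLike.congr_fun (AlgHomClass.commutes ρ r) x
    rw [h]
    exact P.smul_mem r hx
  | id => exact h1
  | star_id => exact h2
  | add f g hf hg =>
    intro x hx
    rw [map_add]
    exact P.add_mem (hf x hx) (hg x hx)
  | mul f g hf hg =>
    intro x hx
    rw [starAlgHom_mul_apply]
    exact hf _ (hg x hx)
  | frequently f hf =>
    intro x hx
    exact isClosed_iff_frequently.1 (hP.preimage (continuous_starAlgHom_apply ρ x)) f
      (hf.mono fun g hg => hg x hx)

variable {ρ}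

theorem starAlgHom_congr (h0 : ∀ f : C(Disc, ℂ), (∀ z : Disc, ‖(z : ℂ)‖ = 1 → f z = 0) → ρ f = 0)
    {f g : C(Disc, ℂ)} (h : ∀ z : Disc, ‖(z : ℂ)‖ = 1 → f z = g z) : ρ f = ρ g := by
  rw [← sub_eq_zero, ← map_sub]
  refine h0 _ fun z hz => ?_
  rw [ContinuousMap.sub_apply, h z hz, sub_self]

/-- On the circle `conj z * z = 1`, and `ρ` ignores the rest of the disc. -/
theorem exists_unitary
    (h0 : ∀ f : C(Disc, ℂ), (∀ z : Disc, ‖(z : ℂ)‖ = 1 → f z = 0) → ρ f = 0) :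
    ∃ U : unitary (K →L[ℂ] K), upow U 1 = ρ coord ∧ upow U (-1) = ρ (star coord) := by
  have h : ρ (star coord * coord) = 1 := by
    rw [← map_one ρ]
    exact starAlgHom_congr h0 fun z hz => star_coord_mul_coord hz
  refine ⟨⟨ρ coord, Unitary.mem_iff.2 ⟨?_, ?_⟩⟩, ?_, ?_⟩
  · rw [← map_star, ← map_mul, h]
  · rw [← map_star, ← map_mul, mul_comm, h]
  · rw [upow_one]
  · rw [upow, zpow_neg_one, ← Unitary.star_eq_inv]
    exact (map_star ρ coord).symm

theorem upow_eq_pow {U : unitary (K →L[ℂ] K)} (hU : upow U 1 = ρ coord) (n : ℕ) :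
    upow U n = ρ (coord ^ n) := by
  rw [map_pow, ← hU, upow_one, upow, zpow_natCast]
  rfl

/-- An isometry from `L²` that intertwines multiplication by `z` intertwines all multiplications
by continuous functions. -/
theorem starAlgHom_intertwine
    (h0 : ∀ f : C(Disc, ℂ), (∀ z : Disc, ‖(z : ℂ)‖ = 1 → f z = 0) → ρ f = 0)
    (J : L2 →ₗᵢ[ℂ] K) (hJ : ∀ n : ℤ, ρ coord (J (fourierLp 2 n)) = J (fourierLp 2 (n + 1)))
    (f : C(Disc, ℂ)) : ∀ g : L2, ρ f (J g) = J (mulL2 (bdry f) g) := by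
  have hcoord : ∀ g : L2, ρ coord (J g) = J (mulL2 (bdry coord) g) := by
    intro g
    refine DFunLike.congr_fun (f := ρ coord ∘L J.toContinuousLinearMap)
      (g := J.toContinuousLinearMap ∘L mulL2 (bdry coord)) (ContinuousLinearMap.ext_on
        (Submodule.dense_iff_topologicalClosure_eq_top.2 (fourierBasis (T := 1)).dense_span) ?_) g
    rintro _ ⟨n, rfl⟩
    change ρ coord (J (fourierBasis n)) = J (mulL2 (bdry coord) (fourierBasis n))
    rw [coe_fourierBasis, hJ, bdry_coord, mulL2_fourier, add_comm]
  induction f using ContinuousMap.induction_on_of_compact with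
  | const r =>
    intro g
    have h : ρ (ContinuousMap.const _ r) (J g) = r • J g :=
      DFunLike.congr_fun (AlgHomClass.commutes ρ r) (J g)
    rw [h, ← map_smul, ← mulL2_const]
    rfl
  | id => exact hcoord
  | star_id =>
    intro g
    change ρ (star coord) (J g) = J (mulL2 (bdry (star coord)) g)
    have h1 : ρ (star coord * coord) = 1 := by
      rw [← map_one ρ]
      exact starAlgHom_congr h0 fun z hz => star_coord_mul_coord hz
    -- Writing `g = z (conj z g)` reduces multiplication by `conj z` to the known case of `z`.
    have h2 : g = mulL2 (bdry coord) (mulL2 (bdry (star coord)) g) := by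
      rw [← mulL2_mul, mul_comm, bdry_star_coord_mul_coord]
      exact ((mulL2_const 1 g).trans (one_smul _ _)).symm
    conv_lhs => rw [h2, ← hcoord, ← starAlgHom_mul_apply, h1]
    rfl
  | add f g hf hg =>
    intro x
    rw [map_add, _root_.add_apply, hf, hg, ← map_add, ← mulL2_add]
    rfl
  | mul f g hf hg =>
    intro x
    rw [starAlgHom_mul_apply, hg, hf, ← mulL2_mul]
    rfl
  | frequently f hf =>
    intro x
    have hb : Continuous bdry := ContinuousMap.continuous_precomp circ
    exact isClosed_iff_frequently.1 (isClosed_eq (continuous_starAlgHom_apply ρ (J x))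
      (J.continuous.comp ((continuous_mulL2 x).comp hb))) f (hf.mono fun g hg => hg x)

end Representation

/-! ### Subspaces between `z² H²` and `H²` -/

theorem inner_fourierLp_of_ne {m n : ℤ} (h : m ≠ n) :
    ⟪fourierLp (T := 1) 2 m, fourierLp (T := 1) 2 n⟫_ℂ = 0 :=
  orthonormal_fourier.2 h

theorem fourierLp_mem_H2 {n : ℤ} (hn : 0 ≤ n) : fourierLp (T := 1) 2 n ∈ H2 :=
  fun _ hm => inner_fourierLp_of_ne (by omega)

/-- The closed subspaces between `z² H²` and `H²` are the spaces `H²_𝒱`. -/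
theorem exists_H2V_eq {N : Submodule ℂ L2} (hN : IsClosed (N : Set L2)) (hNH : N ≤ H2)
    (hz : ∀ n : ℤ, 2 ≤ n → fourierLp 2 n ∈ N) : ∃ W ≤ CCz, H2V W = N := by
  -- The witness is `H² ⊖ N`: its elements are orthogonal to `zⁿ` for `n < 0` and for `n ≥ 2`, so
  -- only the coefficients of index 0 and 1 survive.
  refine ⟨H2 ⊓ Nᗮ, fun f hf => ?_, le_antisymm (fun f hf => ?_) fun f hf => ⟨hNH hf, ?_⟩⟩
  · have h1 := (fourierBasis (T := 1)).hasSum_repr f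
    have h2 := hasSum_sum_of_ne_finset_zero (L := SummationFilter.unconditional ℤ)
      (f := fun n => (fourierBasis (T := 1)).repr f n • fourierBasis (T := 1) n)
      (s := {0, 1}) fun n hn => by
        simp only [Finset.mem_insert, Finset.mem_singleton, not_or] at hn
        rw [HilbertBasis.repr_apply_apply, coe_fourierBasis]
        rcases lt_or_ge n 0 with h | h
        · rw [hf.1 n h, zero_smul]
        · rw [(Submodule.mem_orthogonal _ _).1 hf.2 _ (hz n (by omega)), zero_smul]
    rw [h1.unique h2, coe_fourierBasis]
    exact sum_mem fun n hn => Submodule.smul_mem _ _ (Submodule.subset_span (by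
      simp only [Finset.mem_insert, Finset.mem_singleton] at hn
      rcases hn with rfl | rfl <;> simp))
  · have : CompleteSpace N := hN.completeSpace_coe
    obtain ⟨p, hp, q, hq, rfl⟩ := N.exists_add_mem_mem_orthogonal f
    have hqH : q ∈ H2 := by simpa using H2.sub_mem hf.1 (hNH hp)
    have h1 := (Submodule.mem_orthogonal _ _).1 hf.2 q ⟨hqH, hq⟩
    rw [inner_add_right, ← inner_conj_symm, (Submodule.mem_orthogonal _ _).1 hq p hp, map_zero,
      zero_add, inner_self_eq_zero] at h1
    rwa [h1, add_zero]
  · exact (Submodule.mem_orthogonal _ _).2 fun v hv => by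
      rw [← inner_conj_symm, (Submodule.mem_orthogonal _ _).1 hv.2 f hf, map_zero]

/-! ### Identification of `π` with `π_𝒱` -/

section Model

variable {H : Type u} [NormedAddCommGroup H] [InnerProductSpace ℂ H]
  {K : Type u} [NormedAddCommGroup K] [InnerProductSpace ℂ K] [CompleteSpace K]
  {ρ : C(Disc, ℂ) →⋆ₐ[ℂ] (K →L[ℂ] K)} {π : Rep H} {V : H →ₗᵢ[ℂ] K}

/-- Vectors all of whose shifts lie in the space of a pure representation vanish. -/
theorem eq_zero_of_forall_upow_mem (hp : IsPure π)
    (h0 : ∀ f : C(Disc, ℂ), (∀ z : Disc, ‖(z : ℂ)‖ = 1 → f z = 0) → ρ f = 0)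
    (hV : ∀ (a : neilAlgebra) (h : H), V (π a h) = ρ a (V h))
    {U : unitary (K →L[ℂ] K)} (hU1 : upow U 1 = ρ coord) (hU' : upow U (-1) = ρ (star coord))
    {M : Submodule ℂ K} (hM : IsClosed (M : Set K)) (hMV : ∀ x ∈ M, ∃ h, V h = upow U 2 x)
    {x : K} (hx : ∀ n : ℤ, upow U n x ∈ M) : x = 0 := by
  set R : Submodule ℂ K := ⨅ n : ℤ, M.comap (upow U n).toLinearMap with hR
  have hmem : ∀ y, y ∈ R ↔ ∀ n : ℤ, upow U n y ∈ M := fun y => by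
    rw [hR, Submodule.mem_iInf]; rfl
  have hRc : IsClosed (R : Set K) := by
    rw [hR, Submodule.coe_iInf]
    exact isClosed_iInter fun n => hM.preimage (upow U n).continuous
  have hshift : ∀ m : ℤ, ∀ y ∈ R, upow U m y ∈ R := fun m y hy =>
    (hmem _).2 fun n => by rw [← upow_add]; exact (hmem y).1 hy _
  have hRV : ∀ y ∈ R, ∃ h, V h = y := fun y hy => by
    obtain ⟨h, hh⟩ := hMV _ ((hmem y).1 hy (-2))
    refine ⟨h, hh.trans ?_⟩
    rw [← upow_add, add_neg_cancel, upow_zero]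
  have hρ : ∀ f, ∀ y ∈ R, ρ f y ∈ R := fun f => starAlgHom_mem ρ hRc
    (fun y hy => hU1 ▸ hshift 1 y hy) (fun y hy => hU' ▸ hshift (-1) y hy) f
  have hxR : x ∈ R := (hmem x).2 hx
  obtain ⟨h, rfl⟩ := hRV x hxR
  rw [hp h fun a ha => ?_, map_zero]
  -- `R` reduces `ρ` and lies in the range of `V`. For inner `a`, `ρ(a) ρ(a)* = 1`, so a preimage
  -- under `V` of `ρ(a)* V h` is a preimage of `h` under `π a`.
  obtain ⟨g, hg⟩ := hRV _ (hρ (star (a : C(Disc, ℂ))) _ hxR)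
  refine ⟨g, V.injective ?_⟩
  rw [hV, hg, ← starAlgHom_mul_apply]
  have h1 : ρ ((a : C(Disc, ℂ)) * star (a : C(Disc, ℂ))) = 1 := by
    rw [← map_one ρ]
    refine starAlgHom_congr h0 fun z hz => ?_
    rw [ContinuousMap.mul_apply, ContinuousMap.star_apply, RCLike.star_def, Complex.mul_conj',
      ha z hz]
    simp
  rw [h1]
  rfl

/-- The vectors orthogonal to all `Uⁿ e` form a closed subspace reducing `U`, hence stable under
`ρ`. -/
theorem inner_starAlgHom_wandering
    {U : unitary (K →L[ℂ] K)} (hU1 : upow U 1 = ρ coord) (hU' : upow U (-1) = ρ (star coord))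
    {e e' : K} (h : ∀ n : ℤ, ⟪upow U n e, e'⟫_ℂ = 0) (f : C(Disc, ℂ)) : ⟪e, ρ f e'⟫_ℂ = 0 := by
  set R : Submodule ℂ K := ⨅ n : ℤ, LinearMap.ker (innerSL ℂ (upow U n e)).toLinearMap with hR
  have hmem : ∀ y, y ∈ R ↔ ∀ n : ℤ, ⟪upow U n e, y⟫_ℂ = 0 := fun y => by
    rw [hR, Submodule.mem_iInf]; rfl
  have hRc : IsClosed (R : Set K) := by
    rw [hR, Submodule.coe_iInf]
    exact isClosed_iInter fun n => (innerSL ℂ (upow U n e)).isClosed_ker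
  have hshift : ∀ m : ℤ, ∀ y ∈ R, upow U m y ∈ R := fun m y hy =>
    (hmem _).2 fun n => by
      rw [← neg_neg m, ← inner_upow_left, ← upow_add]; exact (hmem y).1 hy _
  have h1 := (hmem _).1 (starAlgHom_mem ρ hRc (fun y hy => hU1 ▸ hshift 1 y hy)
    (fun y hy => hU' ▸ hshift (-1) y hy) f e' ((hmem e').2 h)) 0
  rwa [upow_zero] at h1

/-- The closed cyclic subspace of a representation generated by a vector. -/
def cyclic (π : Rep H) (x : H) : Submodule ℂ H :=
  (LinearMap.range ({ toFun := fun a => π a x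
                      map_add' := fun a b => by rw [map_add]; rfl
                      map_smul' := fun r a => by rw [map_smul]; rfl } :
    neilAlgebra →ₗ[ℂ] H)).topologicalClosure

theorem apply_mem_cyclic (π : Rep H) (a : neilAlgebra) (x : H) : π a x ∈ cyclic π x :=
  subset_closure ⟨a, rfl⟩

theorem cyclic_le {x : H} {N : Submodule ℂ H} (hN : IsClosed (N : Set H))
    (h : ∀ a, π a x ∈ N) : cyclic π x ≤ N :=
  Submodule.topologicalClosure_minimal _ (by rintro _ ⟨a, rfl⟩; exact h a) hN

theorem isClosed_cyclic (x : H) : IsClosed (cyclic π x : Set H) :=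
  Submodule.isClosed_topologicalClosure _

theorem isInvariant_cyclic (x : H) : IsInvariant π (cyclic π x) := fun b _ hy =>
  cyclic_le (π := π) (x := x) (N := (cyclic π x).comap (π b).toLinearMap)
    ((isClosed_cyclic x).preimage (π b).continuous) (fun a => by
      change π b (π a x) ∈ cyclic π x
      have h : π b (π a x) = π (b * a) x := by rw [map_mul]; rfl
      rw [h]
      exact apply_mem_cyclic π _ x) hy

/-- The closed cyclic subspaces of `x` and `y` are invariant and orthogonal; unitality puts `x` and
`y` in them. -/
theorem IsRankOne.eq_zero_or_eq_zero (hr : IsRankOne π) (hu : IsUnital π) {x y : H}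
    (h : ∀ a b, ⟪π a x, π b y⟫_ℂ = 0) : x = 0 ∨ y = 0 := by
  by_contra! hxy
  have hne : ∀ {w : H}, w ≠ 0 → cyclic π w ≠ ⊥ := fun {w} hw hbot => hw (by
    have h1 := apply_mem_cyclic π 1 w
    have h2 : π 1 = 1 := hu
    rw [hbot, h2] at h1
    exact h1)
  refine hr ⟨cyclic π x, cyclic π y, isClosed_cyclic x, isClosed_cyclic y, hne hxy.1, hne hxy.2,
    ?_, isInvariant_cyclic x, isInvariant_cyclic y⟩
  rw [Submodule.isOrtho_iff_le]
  refine cyclic_le (Submodule.isClosed_orthogonal _) fun a => ?_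
  rw [Submodule.mem_orthogonal']
  have h1 : cyclic π y ≤ LinearMap.ker (innerSL ℂ (π a x)).toLinearMap :=
    cyclic_le (innerSL ℂ (π a x)).isClosed_ker fun b => h a b
  exact fun w hw => h1 hw

/-- Unitary equivalence with `π_𝒱` from a model in `L²`. -/
theorem unitarilyEquiv_of_model {J : L2 →ₗᵢ[ℂ] K}
    (hV : ∀ (a : neilAlgebra) (h : H), V (π a h) = ρ a (V h))
    (hJ : ∀ (f : C(Disc, ℂ)) (g : L2), ρ f (J g) = J (mulL2 (bdry f) g))
    {W : Submodule ℂ L2} (hW : W ≤ CCz) (hVJ : ∀ x, (∃ h, V h = x) ↔ ∃ f ∈ H2V W, J f = x) :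
    UnitarilyEquiv π (piV W hW) := by
  let T : H2V W →ₗᵢ[ℂ] K := J.comp (H2V W).subtypeₗᵢ
  have hrange : LinearMap.range V.toLinearMap = LinearMap.range T.toLinearMap := by
    ext x
    refine (hVJ x).trans ⟨?_, ?_⟩
    · rintro ⟨f, hf, rfl⟩
      exact ⟨⟨f, hf⟩, rfl⟩
    · rintro ⟨f, rfl⟩
      exact ⟨f, f.2, rfl⟩
  let Ψ : H ≃ₗᵢ[ℂ] H2V W := V.equivRange.trans
    ((LinearIsometryEquiv.ofEq _ _ hrange).trans T.equivRange.symm)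
  have hΨ : ∀ h, T (Ψ h) = V h := fun h =>
    congrArg Subtype.val (T.equivRange.apply_symm_apply
      (LinearIsometryEquiv.ofEq _ _ hrange (V.equivRange h)))
  refine ⟨Ψ, fun a h => T.injective ?_⟩
  rw [hΨ, hV, ← hΨ]
  exact hJ a (Ψ h)

theorem exists_unitarilyEquiv_piV [CompleteSpace H] [Nontrivial H] (hu : IsUnital π)
    (hp : IsPure π) (he : IsExtremal π) (hc : IsCompletelyContractive π) (hr : IsRankOne π) :
    ∃ (W : Submodule ℂ L2) (hW : W ≤ CCz), UnitarilyEquiv π (piV W hW) := by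
  obtain ⟨K, _, _, _, ρ, V, h0, hV⟩ := exists_extension hu hc he
  obtain ⟨U, hU1, hU'⟩ := exists_unitary h0
  set P : Submodule ℂ K := LinearMap.range V.toLinearMap with hPdef
  have hPc : IsClosed (P : Set K) := V.isometry.isClosedEmbedding.isClosed_range
  have hPπ : ∀ (m : ℕ), m ≠ 1 → ∀ x ∈ P, upow U m x ∈ P := by
    rintro m hm _ ⟨h, rfl⟩
    rw [upow_eq_pow hU1]
    exact ⟨π (monomial m hm) h, hV _ _⟩
  -- Two summands suffice for `U`-invariance because `U² P ⊆ P`; together with `U³ P ⊆ P` this also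
  -- gives `U² M ⊆ P`.
  set M : Submodule ℂ K := (P ⊔ P.map (upow U 1).toLinearMap).topologicalClosure with hMdef
  have hMc : IsClosed (M : Set K) := Submodule.isClosed_topologicalClosure _
  have hPM : P ≤ M := le_sup_left.trans (Submodule.le_topologicalClosure _)
  have hMP : ∀ x ∈ M, upow U 2 x ∈ P := by
    refine Submodule.topologicalClosure_minimal _ (t := P.comap (upow U 2).toLinearMap)
      (sup_le (hPπ 2 (by norm_num)) ?_) (hPc.preimage (upow U 2).continuous)
    rintro _ ⟨x, hx, rfl⟩
    change upow U 2 (upow U 1 x) ∈ P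
    rw [← upow_add]
    exact hPπ 3 (by norm_num) x hx
  have hUM : ∀ x ∈ M, upow U 1 x ∈ M := by
    refine Submodule.topologicalClosure_minimal _ (t := M.comap (upow U 1).toLinearMap)
      (sup_le (fun x hx => ?_) ?_) (hMc.preimage (upow U 1).continuous)
    · exact Submodule.le_topologicalClosure _ (le_sup_right (α := Submodule ℂ K) ⟨x, hx, rfl⟩)
    · rintro _ ⟨x, hx, rfl⟩
      change upow U 1 (upow U 1 x) ∈ M
      rw [← upow_add]
      exact hPM (hPπ 2 (by norm_num) x hx)
  have hM0 : M ≠ ⊥ := by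
    obtain ⟨h, hh⟩ := exists_ne (0 : H)
    intro hbot
    have h1 : V h ∈ M := hPM ⟨h, rfl⟩
    rw [hbot, Submodule.mem_bot, ← map_zero V] at h1
    exact hh (V.injective h1)
  have hR : ∀ x, (∀ n : ℕ, upow U (-n) x ∈ M) → x = 0 := by
    refine fun x hx => eq_zero_of_forall_upow_mem hp h0 hV hU1 hU' hMc hMP fun n => ?_
    obtain ⟨k, rfl | rfl⟩ := n.eq_nat_or_neg
    · exact upow_mem hUM k (by simpa [upow_zero] using hx 0)
    · exact hx k
  have hL : ∀ e ∈ M, ∀ e' ∈ M, (∀ y ∈ M, ⟪upow U 1 y, e⟫_ℂ = 0) →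
      (∀ y ∈ M, ⟪upow U 1 y, e'⟫_ℂ = 0) → ⟪e, e'⟫_ℂ = 0 → e = 0 ∨ e' = 0 := by
    intro e heM e' heM' hw hw' hee'
    have h1 : ∀ n : ℤ, ⟪upow U n e, e'⟫_ℂ = 0 := fun n => by
      rcases eq_or_ne n 0 with rfl | hn
      · rwa [upow_zero]
      · exact inner_upow_wandering hUM heM heM' hw hw' hn
    have h2 := inner_starAlgHom_wandering hU1 hU' h1
    -- Wandering vectors need not lie in `P`, but `U² e` and `U² e'` do, so the rank one hypothesis
    -- is applied to these.
    obtain ⟨x, hx⟩ := hMP e heM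
    obtain ⟨y, hy⟩ := hMP e' heM'
    have hU2 : upow U 2 = ρ (coord ^ 2) := upow_eq_pow hU1 2
    have hz : ∀ {w : K} {h : H}, V h = upow U 2 w → h = 0 → w = 0 := by
      rintro w h hh rfl
      rw [← upow_neg_upow U 2 w, ← hh, map_zero, map_zero]
    refine (hr.eq_zero_or_eq_zero hu (x := x) (y := y) fun a b => ?_).imp (hz hx) (hz hy)
    rw [← V.inner_map_map, hV, hV]
    erw [hx, hy]
    rw [hU2, ← starAlgHom_mul_apply, ← starAlgHom_mul_apply, inner_starAlgHom_left,
      ← starAlgHom_mul_apply]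
    exact h2 _
  obtain ⟨J, hJU, hJM⟩ := exists_shift_model hMc hM0 hUM hR hL
  have hJ := starAlgHom_intertwine h0 J fun n => hU1 ▸ hJU n
  -- `P ⊆ M` gives containment in `H²`; `zⁿ = z² z^(n-2)` and `U² M ⊆ P` give the monomials with `n
  -- ≥ 2`.
  obtain ⟨W, hW, hWP⟩ := exists_H2V_eq (N := P.comap J.toLinearMap) (hPc.preimage J.continuous)
    (fun f hf => by
      obtain ⟨g, hg, hgf⟩ := (hJM _).1 (hPM hf)
      rwa [← J.injective hgf])
    (fun n hn => by
      have h1 := hMP _ ((hJM _).2 ⟨_, fourierLp_mem_H2 (n := n - 2) (by omega), rfl⟩)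
      rwa [show (2 : ℤ) = 1 + 1 by norm_num, upow_add, hJU, hJU,
        show n - (1 + 1) + 1 + 1 = n by ring] at h1)
  refine ⟨W, hW, unitarilyEquiv_of_model hV hJ hW fun x => ⟨fun hx => ?_, ?_⟩⟩
  · obtain ⟨f, -, rfl⟩ := (hJM x).1 (hPM hx)
    exact ⟨f, hWP ▸ hx, rfl⟩
  · rintro ⟨f, hf, rfl⟩
    rw [hWP] at hf
    exact hf

end Model

/-! ### Rank one of `π_𝒱` -/

/-- An integrable function that is orthogonal to the continuous functions vanishes. -/
theorem ae_eq_zero_of_forall_integral_continuous_mul {X : Type*} [PseudoMetricSpace X]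
    [MeasurableSpace X] [BorelSpace X] {μ : Measure X} {f : X → ℂ} (hf : Integrable f μ)
    (h : ∀ p : C(X, ℂ), ∫ x, p x * f x ∂μ = 0) : f =ᵐ[μ] 0 := by
  refine ae_eq_zero_of_forall_setIntegral_isClosed_eq_zero hf fun s hs => ?_
  -- Thickened indicators are continuous and decrease to the indicator of the closed set `s`;
  -- dominated convergence transfers the vanishing of the integrals.
  obtain ⟨δ, -, hδ0, hδ⟩ := exists_seq_strictAnti_tendsto (0 : ℝ)
  have hlim := thickenedIndicator_tendsto_indicator_closure hδ0 hδ s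
  have h1 : Filter.Tendsto (fun n => ∫ x, ((thickenedIndicator (hδ0 n) s x : ℝ) : ℂ) * f x ∂μ)
      Filter.atTop (nhds (∫ x, s.indicator f x ∂μ)) := by
    refine tendsto_integral_of_dominated_convergence (fun x => ‖f x‖) (fun n => ?_) hf.norm
      (fun n => Filter.Eventually.of_forall fun x => ?_) (Filter.Eventually.of_forall fun x => ?_)
    · refine AEStronglyMeasurable.mul (Continuous.aestronglyMeasurable ?_) hf.1
      fun_prop
    · rw [norm_mul]
      refine mul_le_of_le_one_left (norm_nonneg _) ?_
      simpa using thickenedIndicator_le_one (hδ0 n) s x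
    · have h2 := (tendsto_pi_nhds.1 hlim) x
      rw [hs.closure_eq] at h2
      have h3 : Continuous fun r : NNReal => ((r : ℝ) : ℂ) * f x := by fun_prop
      have h5 : s.indicator f x = (((s.indicator (fun _ => (1 : NNReal)) x : NNReal) : ℝ) : ℂ) * f x := by
        by_cases hx : x ∈ s <;> simp [hx]
      rw [h5]
      exact (h3.tendsto _).comp h2
  rw [← integral_indicator hs.measurableSet]
  refine tendsto_nhds_unique h1 ?_
  have h4 : ∀ n, ∫ x, ((thickenedIndicator (hδ0 n) s x : ℝ) : ℂ) * f x ∂μ = 0 := fun n =>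
    h ((⟨fun r : NNReal => ((r : ℝ) : ℂ), by fun_prop⟩ : C(NNReal, ℂ)).comp
      (thickenedIndicator (hδ0 n) s).toContinuousMap)
  simp only [h4]
  exact tendsto_const_nhds

/-- The integrable function `conj f * g` is orthogonal to all continuous functions. The conjugate is
dropped, as it does not affect zeros and the product of two `H²` functions is wanted. -/
theorem ae_mul_eq_zero_of_orthogonal {f g : L2}
    (h : ∀ p : C(UnitAddCircle, ℂ), ⟪mulL2 p f, g⟫_ℂ = 0) :
    ∀ᵐ t ∂(haarAddCircle : Measure UnitAddCircle), f t * g t = 0 := by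
  have h1 := ae_eq_zero_of_forall_integral_continuous_mul
    (L2.integrable_inner (𝕜 := ℂ) f g) fun p => by
      rw [← h (star p), L2.inner_def]
      refine integral_congr_ae ?_
      filter_upwards [coeFn_mulL2 (star p) f] with t ht
      rw [ht]
      simp only [RCLike.inner_apply, ContinuousMap.star_apply, RCLike.star_def, map_mul,
        RCLike.conj_conj]
      ring
  filter_upwards [h1] with t ht
  simpa [or_comm] using ht

/-- Parseval's identity for `zⁿ conj f` and `g`; the product `f g` itself is merely integrable. -/
theorem hasSum_fourierCoeff_mul (f g : L2) (n : ℤ) :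
    HasSum (fun k : ℤ => ⟪fourierLp (T := 1) 2 (n - k), f⟫_ℂ * ⟪fourierLp (T := 1) 2 k, g⟫_ℂ)
      (∫ t : UnitAddCircle, fourier (-n) t * (f t * g t) ∂haarAddCircle) := by
  set w : L2 := mulL2 (fourier n) (star f) with hw
  have hwt : ∀ᵐ t ∂(haarAddCircle : Measure UnitAddCircle), w t = fourier n t * conj (f t) := by
    filter_upwards [coeFn_mulL2 (fourier n) (star f), Lp.coeFn_star f] with t h1 h2
    rw [h1, h2]; rfl
  have h := (fourierBasis (T := 1)).hasSum_inner_mul_inner w g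
  simp only [coe_fourierBasis] at h
  have h1 : ∀ k : ℤ, ⟪w, fourierLp (T := 1) 2 k⟫_ℂ = ⟪fourierLp (T := 1) 2 (n - k), f⟫_ℂ := by
    intro k
    rw [L2.inner_def, L2.inner_def]
    refine integral_congr_ae ?_
    filter_upwards [hwt, coeFn_fourierLp (T := 1) 2 k, coeFn_fourierLp (T := 1) 2 (n - k)]
      with t h1 h2 h3
    simp only [RCLike.inner_apply, h1, h2, h3, map_mul, RCLike.conj_conj, ← fourier_neg]
    rw [neg_sub, sub_eq_add_neg, fourier_add]
    ring
  have h2 : ⟪w, g⟫_ℂ = ∫ t : UnitAddCircle, fourier (-n) t * (f t * g t) ∂haarAddCircle := by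
    rw [L2.inner_def]
    refine integral_congr_ae ?_
    filter_upwards [hwt] with t h1
    simp only [RCLike.inner_apply, h1, map_mul, RCLike.conj_conj, ← fourier_neg]
    ring
  simp only [h1] at h
  rw [← h2]
  exact h

/-- The power series of a function in `L²` given by the nonnegative Fourier coefficients. -/
def fourierSeries (f : L2) : PowerSeries ℂ :=
  PowerSeries.mk fun n => ⟪fourierLp (T := 1) 2 (n : ℤ), f⟫_ℂ

theorem eq_zero_of_fourierSeries_eq_zero {f : L2} (hf : f ∈ H2) (h : fourierSeries f = 0) :
    f = 0 := by
  rw [← (fourierBasis (T := 1)).repr.map_eq_zero_iff]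
  ext n
  rw [HilbertBasis.repr_apply_apply, coe_fourierBasis]
  rcases lt_or_ge n 0 with hn | hn
  · exact hf n hn
  · obtain ⟨k, rfl⟩ := Int.eq_ofNat_of_zero_le hn
    simpa [fourierSeries] using congrArg (PowerSeries.coeff k) h

/-- The product of two nonzero functions in `H²` does not vanish almost everywhere. -/
theorem eq_zero_or_eq_zero_of_mul {f g : L2} (hf : f ∈ H2) (hg : g ∈ H2)
    (h : ∀ᵐ t ∂(haarAddCircle : Measure UnitAddCircle), f t * g t = 0) : f = 0 ∨ g = 0 := by
  -- For `H²` functions the convolution reduces to the finite Cauchy product over `0 ≤ k ≤ n`, so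
  -- the coefficients of the product series are the Fourier coefficients of `f g = 0`.
  have h1 : fourierSeries f * fourierSeries g = 0 := by
    ext n
    have h2 := hasSum_fourierCoeff_mul f g n
    rw [integral_eq_zero_of_ae (by
      filter_upwards [h] with t ht
      rw [ht, mul_zero]; rfl)] at h2
    have h3 := hasSum_sum_of_ne_finset_zero (L := SummationFilter.unconditional ℤ)
      (f := fun k : ℤ => ⟪fourierLp (T := 1) 2 (n - k), f⟫_ℂ * ⟪fourierLp (T := 1) 2 k, g⟫_ℂ)
      (s := (Finset.range (n + 1)).map Nat.castEmbedding) fun k hk => by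
        rcases lt_or_ge k 0 with h0 | h0
        · rw [hg k h0, mul_zero]
        · obtain ⟨j, rfl⟩ := Int.eq_ofNat_of_zero_le h0
          rw [hf _ ?_, zero_mul]
          by_contra hj
          exact hk (Finset.mem_map.2 ⟨j, Finset.mem_range.2 (by omega), rfl⟩)
    have h4 := h3.unique h2
    rw [Finset.sum_map] at h4
    rw [PowerSeries.coeff_mul, map_zero, ← Finset.Nat.sum_antidiagonal_swap,
      Finset.Nat.sum_antidiagonal_eq_sum_range_succ_mk, ← h4]
    refine Finset.sum_congr rfl fun k hk => ?_
    have hk' : k ≤ n := Nat.lt_succ_iff.1 (Finset.mem_range.1 hk)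
    simp [fourierSeries, Nat.cast_sub hk']
  exact (mul_eq_zero.1 h1).imp (eq_zero_of_fourierSeries_eq_zero hf)
    (eq_zero_of_fourierSeries_eq_zero hg)

theorem bdry_coord_pow (m : ℕ) : bdry (coord ^ m) = fourier (m : ℤ) := by
  ext1 t
  change (fourier 1 t : ℂ) ^ m = fourier (m : ℤ) t
  simp [fourier_apply, AddCircle.toCircle_nsmul]

theorem inner_mulL2_left (p : C(UnitAddCircle, ℂ)) (f g : L2) :
    ⟪mulL2 p f, g⟫_ℂ = ⟪f, mulL2 (star p) g⟫_ℂ := by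
  rw [L2.inner_def, L2.inner_def]
  refine integral_congr_ae ?_
  filter_upwards [coeFn_mulL2 p f, coeFn_mulL2 (star p) g] with t h1 h2
  rw [h1, h2]
  simp only [RCLike.inner_apply, ContinuousMap.star_apply, RCLike.star_def, map_mul]
  ring

theorem isRankOne_piV (W : Submodule ℂ L2) (hW : W ≤ CCz) : IsRankOne (piV W hW) := by
  rintro ⟨M, N, -, -, hM, hN, hMN, hMi, hNi⟩
  obtain ⟨f, hfM, hf0⟩ := (Submodule.ne_bot_iff M).1 hM
  obtain ⟨g, hgN, hg0⟩ := (Submodule.ne_bot_iff N).1 hN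
  have h1 : ∀ j k : ℕ, j ≠ 1 → k ≠ 1 →
      ⟪mulL2 (fourier ((j : ℤ) - k)) (f : L2), (g : L2)⟫_ℂ = 0 := by
    intro j k hj hk
    have h2 : ⟪piV W hW (monomial j hj) f, piV W hW (monomial k hk) g⟫_ℂ = 0 :=
      Submodule.isOrtho_iff_inner_eq.1 hMN _ (hMi _ f hfM) _ (hNi _ g hgN)
    change ⟪mulL2 (bdry (coord ^ j)) (f : L2), mulL2 (bdry (coord ^ k)) (g : L2)⟫_ℂ = 0 at h2
    have h3 : (fourier ((j : ℤ) - k) : C(UnitAddCircle, ℂ)) = star (fourier (k : ℤ)) *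
        fourier (j : ℤ) := by
      ext1 t
      rw [ContinuousMap.mul_apply, ContinuousMap.star_apply, RCLike.star_def, ← fourier_neg,
        ← fourier_add, sub_eq_neg_add]
    rw [h3, mulL2_mul, inner_mulL2_left, star_star, ← bdry_coord_pow, ← bdry_coord_pow]
    exact h2
  have h2 : ∀ p : C(UnitAddCircle, ℂ), ⟪mulL2 p (f : L2), (g : L2)⟫_ℂ = 0 := by
    let R : Submodule ℂ C(UnitAddCircle, ℂ) :=
      { carrier := {p | ⟪mulL2 p (f : L2), (g : L2)⟫_ℂ = 0}
        add_mem' := fun {p q} hp hq => by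
          change ⟪mulL2 (p + q) (f : L2), (g : L2)⟫_ℂ = 0
          rw [mulL2_add, inner_add_left, hp, hq, add_zero]
        zero_mem' := by
          have h : mulL2 0 (f : L2) = 0 := by simp [mulL2]
          change ⟪mulL2 0 (f : L2), (g : L2)⟫_ℂ = 0
          rw [h, inner_zero_left]
        smul_mem' := fun c p hp => by
          have h : mulL2 (c • p) (f : L2) = c • mulL2 p (f : L2) := by simp [mulL2]
          change ⟪mulL2 (c • p) (f : L2), (g : L2)⟫_ℂ = 0
          rw [h, inner_smul_left, hp, mul_zero] }
    have hR : IsClosed (R : Set C(UnitAddCircle, ℂ)) :=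
      isClosed_eq ((continuous_mulL2 (f : L2)).inner continuous_const) continuous_const
    have hle : (Submodule.span ℂ (Set.range (fourier (T := 1)))).topologicalClosure ≤ R := by
      refine Submodule.topologicalClosure_minimal _ (Submodule.span_le.2 ?_) hR
      rintro _ ⟨n, rfl⟩
      -- Shifting the positive and negative parts of `n` by 2 avoids the forbidden exponent 1 and
      -- keeps the difference `n`.
      have h := h1 (n.toNat + 2) ((-n).toNat + 2) (by omega) (by omega)
      rwa [show ((n.toNat + 2 : ℕ) : ℤ) - ((-n).toNat + 2 : ℕ) = n by omega] at h
    rw [span_fourier_closure_eq_top] at hle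
    exact fun p => hle (Submodule.mem_top (x := p))
  exact (eq_zero_or_eq_zero_of_mul f.2.1 g.2.1 (ae_mul_eq_zero_of_orthogonal h2)).elim
    (fun h => hf0 (Subtype.ext h)) (fun h => hg0 (Subtype.ext h))

end NeilAlg

end

theorem corollary4p2 :
    (∀ (V : Submodule ℂ NeilAlg.L2) (hV : V ≤ NeilAlg.CCz),
      NeilAlg.IsRankOne (NeilAlg.piV V hV)) ∧
    (∀ (H : Type u) [NormedAddCommGroup H] [InnerProductSpace ℂ H] [CompleteSpace H]
      [Nontrivial H] (π : NeilAlg.Rep H),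
      NeilAlg.IsUnital π → NeilAlg.IsPure π → NeilAlg.IsExtremal π →
      NeilAlg.IsCompletelyContractive π → NeilAlg.IsRankOne π →
      ∃ (V : Submodule ℂ NeilAlg.L2) (hV : V ≤ NeilAlg.CCz),
        NeilAlg.UnitarilyEquiv π (NeilAlg.piV V hV)) := by
  refine ⟨NeilAlg.isRankOne_piV, ?_⟩
  intro H _ _ _ _ π hu hp he hc hr
  exact NeilAlg.exists_unitarilyEquiv_piV hu hp he hc hr
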